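/- Let $n\in\mathbb N$, $T>0$, and let $\theta_j=\gamma_j/q_j$ ($1\le j\le n$) be positive rationals in lowest terms with $q_j\ge 2$; put $m_j=\lceil\theta_j\rceil$ and $q=\operatorname{lcm}(q_1,\dots,q_n)$. Let $p_{j,r}$ ($1\le j\le n$, $1\le r\le n+1$) be complex-valued functions, continuous on $[0,T]$, of the form $$p_{j,r}(t)=f_{j,r}(t)\,e^{i\omega t}\qquad(\omega\in\mathbb R),$$ and such that $p_{j,r}(t)=\bar p_{j,r}(t^{1/q})$ on $[0,T]$ with $\bar p_{j,r}$ (real-variable, complex-valued) analytic near $0$. Let complex initial data $v_{j,0}^{(k)}$ ($0\le k<m_j$) be given, and consider the linear Caputo system $$D_C^{\theta_j}v_j(t)=\sum_{r=1}^n p_{j,r}(t)v_r(t)+p_{j,n+1}(t),\qquad v_j^{(k)}(0)=v_{j,0}^{(k)}\quad(0\le k<m_j),\tag{1}$$ where, with $m=\lceil\theta\rceil$, $D_C^{\theta}v(t)=\frac1{\Gamma(m-\theta)}\int_0^t(t-s)^{m-\theta-1}v^{(m)}(s)\,ds$. For $0<S\le T$, a solution of (1) on $[0,S]$ is a tuple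 $(v_j)$ such that $v_j\in C^{m_j-1}[0,S]$ with $v_j^{(m_j-1)}$ absolutely continuous, the initial conditions hold, and for every $t\in(0,S]$ the integrals defining $D_C^{\theta_j}v_j(t)$ converge and the equations in (1) hold. Write $f_{j,r,m}$ for the Taylor coefficients at $0$ of $z\mapsto\bar p_{j,r}(z)e^{-i\omega z^q}$, and $\psi_j(t)=\sum_{k<m_j}\frac{v_{j,0}^{(k)}}{k!}t^k$. Then: 1. There is exactly one family of complex numbers $\bar v_{j,\mu}$ ($1\le j\le n$, $\mu\ge0$) such that, for $\mu<\theta_jq$, $\bar v_{j,\mu}=v_{j,0}^{(\mu/q)}/(\mu/q)!$ if $q\mid\mu$ and $\bar v_{j,\mu}=0$ otherwise, and, for $\mu\ge\theta_jq$, $$\bar v_{j,\mu}=\frac{\Gamma(\frac\mu q-\theta_j+1)}{\Gamma(\frac\mu q+1)}\Bigg(\sum_{r=1}^n\ \sum_{\substack{m_1,m_2\ge0\\ m_1+qm_2\le\mu-\theta_jq}}f_{j,r,m_1}\frac{(i\omega)^{m_2}}{m_2!}\,\bar v_{r,\,\mu-\theta_jq-m_1-qm_2}+\sum_{\substack{m_1,m_2\ge0\\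 m_1+qm_2=\mu-\theta_jq}}f_{j,n+1,m_1}\frac{(i\omega)^{m_2}}{m_2!}\Bigg).$$ 2. There is $\delta\in(0,T]$ such that, for all $j$ and $r$: $f_{j,r}(t)=\sum_{m\ge0}f_{j,r,m}\,t^{m/q}$ on $[0,\delta]$; $\sum_{\mu\ge0}|\bar v_{j,\mu}|\,\delta^{\mu/q}<\infty$ (so $\sum_\mu\bar v_{j,\mu}t^{\mu/q}$ converges absolutely and uniformly on $[0,\delta]$); the system (1) has a solution on $[0,\delta]$; and for every $S\in(0,T]$ and every solution $(v_j)$ of (1) on $[0,S]$, $$v_j(t)=\psi_j(t)+\sum_{\mu=\theta_jq}^{\infty}\bar v_{j,\mu}\,t^{\mu/q}\qquad(1\le j\le n,\ 0\le t\le\min(\delta,S)).$$ -/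

import Mathlib

open Set

/-- `t ^ (μ / q)` for real `t`, as a complex number. -/
noncomputable def fracPow (q μ : ℕ) (t : ℝ) : ℂ := ((t ^ ((μ : ℝ) / (q : ℝ)) : ℝ) : ℂ)

/-- The integrand `(t - s) ^ (α - 1) g(s)` of the Riemann-Liouville integral of order `α`
with base point `0`. -/
noncomputable def rlIntegrand (α : ℝ) (g : ℝ → ℂ) (t s : ℝ) : ℂ :=
  (((t - s) ^ (α - 1) : ℝ) : ℂ) * g s

/-- The Riemann-Liouville fractional integral
`(I^α g)(t) = (1 / Γ(α)) ∫₀ᵗ (t - s) ^ (α - 1) g(s) ds`. -/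
noncomputable def rlIntegral (α : ℝ) (g : ℝ → ℂ) (t : ℝ) : ℂ :=
  ((1 / Real.Gamma α : ℝ) : ℂ) * ∫ s in (0 : ℝ)..t, rlIntegrand α g t s

/-- `v`, given on `[0, S]`, has at `t` the Caputo derivative `w` of order `θ`:
with `m = ⌈θ⌉`, the integral defining `(I^(m - θ) v^(m))(t)` converges and its value is `w`. -/
def HasCaputoDerivAt (S θ : ℝ) (v : ℝ → ℂ) (w : ℂ) (t : ℝ) : Prop :=
  IntervalIntegrable
      (rlIntegrand ((⌈θ⌉₊ : ℝ) - θ) (iteratedDerivWithin ⌈θ⌉₊ v (Icc 0 S)) t)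
      MeasureTheory.volume 0 t ∧
    rlIntegral ((⌈θ⌉₊ : ℝ) - θ) (iteratedDerivWithin ⌈θ⌉₊ v (Icc 0 S)) t = w

/-- The class `AC^m[0, S]` (for `m ≥ 1`): `v` is `m - 1` times continuously differentiable on
`[0, S]`, and its derivative of order `m - 1` is absolutely continuous there. -/
def IsACDiffOn (m : ℕ) (S : ℝ) (v : ℝ → ℂ) : Prop :=
  ContDiffOn ℝ ((m - 1 : ℕ) : WithTop ℕ∞) v (Icc 0 S) ∧
    AbsolutelyContinuousOnInterval (iteratedDerivWithin (m - 1) v (Icc 0 S)) 0 S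

/-- `v = (v_1, …, v_n)` solves on `[0, S]` the linear Caputo system
`D^{θ_j} v_j = ∑_{r ≤ n} p_{j,r} v_r + p_{j,n+1}`, `v_j^{(k)}(0) = v0 j k` for `k < ⌈θ_j⌉`.
The index `r = n + 1` is `Fin.last n`. The equation is required at every `t ∈ (0, S]`: at `t = 0`
the integral that defines the Caputo derivative is over a single point. -/
structure IsCaputoSolution {n : ℕ} (θ : Fin n → ℚ) (p : Fin n → Fin (n + 1) → ℝ → ℂ)
    (v0 : Fin n → ℕ → ℂ) (S : ℝ) (v : Fin n → ℝ → ℂ) : Prop where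
  regular : ∀ j, IsACDiffOn ⌈(θ j : ℝ)⌉₊ S (v j)
  initial : ∀ j, ∀ k < ⌈(θ j : ℝ)⌉₊, iteratedDerivWithin k (v j) (Icc 0 S) 0 = v0 j k
  equation : ∀ j, ∀ t ∈ Ioc 0 S,
    HasCaputoDerivAt S (θ j : ℝ) (v j)
      (∑ r : Fin n, p j r.castSucc t * v r t + p j (Fin.last n) t) t

/-- `q`, the least common multiple of the denominators of the orders. -/
def commonDen {n : ℕ} (θ : Fin n → ℚ) : ℕ := Finset.univ.lcm fun j => (θ j).den

/-- The natural number `θ_j q` (for positive `θ_j`). -/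
def startIndex {n : ℕ} (θ : Fin n → ℚ) (j : Fin n) : ℕ :=
  (θ j).num.toNat * (commonDen θ / (θ j).den)

theorem startIndex_cast {n : ℕ} (θ : Fin n → ℚ) (hθ : ∀ j, 0 < θ j) (j : Fin n) :
    (startIndex θ j : ℚ) = θ j * commonDen θ := by
  have hd : (θ j).den ∣ commonDen θ := Finset.dvd_lcm (Finset.mem_univ j)
  have hd0 : ((θ j).den : ℚ) ≠ 0 := by exact_mod_cast (θ j).den_nz
  have hn : (((θ j).num.toNat : ℕ) : ℚ) = ((θ j).num : ℚ) := by
    have h : (((θ j).num.toNat : ℕ) : ℤ) = (θ j).num :=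
      Int.toNat_of_nonneg (Rat.num_pos.2 (hθ j)).le
    exact_mod_cast h
  unfold startIndex
  rw [Nat.cast_mul, Nat.cast_div hd hd0, hn]
  conv_rhs => rw [← Rat.num_div_den (θ j)]
  ring

/-- The Taylor polynomial `ψ_j(t) = ∑_{k < ⌈θ_j⌉} v0 j k / k! t^k` of the initial data. -/
noncomputable def initialPoly {n : ℕ} (θ : Fin n → ℚ) (v0 : Fin n → ℕ → ℂ) (j : Fin n)
    (t : ℝ) : ℂ :=
  ∑ k ∈ Finset.range ⌈(θ j : ℝ)⌉₊, v0 j k / (k.factorial : ℂ) * (t : ℂ) ^ k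

/-- The coefficients `f_{j,r,m}` of `f_{j,r}(t) = p̄_{j,r}(t^{1/q}) e^{-iωt}` in powers of `t^{1/q}`,
i.e. the Taylor coefficients at `0` of `z ↦ p̄_{j,r}(z) e^{-iω z^q}`. -/
noncomputable def amplitudeCoeff (q : ℕ) (ω : ℝ) (pbar : ℝ → ℂ) (m : ℕ) : ℂ :=
  iteratedDeriv m
    (fun z : ℝ => pbar z * Complex.exp (-(Complex.I * (ω : ℂ) * (z : ℂ) ^ q))) 0 /
      (m.factorial : ℂ)

/-- The recurrence for the coefficients `c j μ` of `t^{μ/q}` in `v_j`. Here `a j r m` are the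
coefficients of `f_{j,r}` in powers of `t^{1/q}`, and the factors `(iω)^{m₂} / m₂!` are those of
`e^{iωt} = ∑ (iω)^{m₂} / m₂! (t^{1/q})^{q m₂}`. -/
structure IsCoeffFamily {n : ℕ} (θ : Fin n → ℚ) (ω : ℝ) (a : Fin n → Fin (n + 1) → ℕ → ℂ)
    (v0 : Fin n → ℕ → ℂ) (c : Fin n → ℕ → ℂ) : Prop where
  low : ∀ j, ∀ μ < startIndex θ j,
    c j μ = if commonDen θ ∣ μ then
      v0 j (μ / commonDen θ) / ((μ / commonDen θ).factorial : ℂ) else 0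
  high : ∀ j, ∀ μ, startIndex θ j ≤ μ →
    c j μ =
      ((Real.Gamma ((μ : ℝ) / commonDen θ - θ j + 1) /
          Real.Gamma ((μ : ℝ) / commonDen θ + 1) : ℝ) : ℂ) *
        ((∑ r : Fin n, ∑ m₁ ∈ Finset.range (μ - startIndex θ j + 1),
            ∑ m₂ ∈ Finset.range (μ - startIndex θ j + 1),
              if m₁ + commonDen θ * m₂ ≤ μ - startIndex θ j then
                a j r.castSucc m₁ * ((Complex.I * (ω : ℂ)) ^ m₂ / (m₂.factorial : ℂ)) *
                  c r (μ - startIndex θ j - (m₁ + commonDen θ * m₂))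
              else 0) +
          ∑ m₁ ∈ Finset.range (μ - startIndex θ j + 1),
            ∑ m₂ ∈ Finset.range (μ - startIndex θ j + 1),
              if m₁ + commonDen θ * m₂ = μ - startIndex θ j then
                a j (Fin.last n) m₁ * ((Complex.I * (ω : ℂ)) ^ m₂ / (m₂.factorial : ℂ))
              else 0)

/-! Write `I^α` for the Riemann-Liouville integral. Beta integrals give `I^θ t^x = Γ(x+1)/Γ(x+θ+1)
t^(x+θ)` for `x > -1`. Hence in the variable `z = t^(1/q)` the Volterra form `v_j = ψ_j + I^{θ_j}(∑
p_{j,r} v_r + p_{j,n+1})` of the system is an identity between power series: `I^{θ_j}` shifts the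
index by `θ_j q` and multiplies by a Gamma quotient. Matching coefficients gives the recurrence. The
shift is at least one, so every coefficient depends on earlier ones only, which settles existence
and uniqueness of the family (`existsUnique_of_causal`).

Convergence: the coefficients of the `p_{j,r}` grow at most geometrically and the Gamma quotients
are bounded (`Gamma_div_Gamma_add_le`), so induction along the recurrence gives geometric growth of
the `c j μ` (`IsCoeffFamily.exists_norm_le`).

Existence: no series is differentiated. A series `w` is written down for the derivative of order
`⌈θ⌉`; it may blow up at `0` but is integrable. The solution is its repeated primitive with the
prescribed initial values, and both `I^⌈θ⌉ w` and `I^(⌈θ⌉-θ) w` are computed termwise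
(`rlIntegral_tsum`, `exists_hasCaputoDerivAt_series`).

Uniqueness: Taylor's formula and the semigroup law (`taylor_rlIntegral`, `rlIntegral_rlIntegral`)
put every solution into Volterra form. The difference of two solutions satisfies a homogeneous
Volterra system, which has only the zero solution because `I^θ` is small in an exponentially
weighted norm (`eq_zero_of_eq_rlIntegral`). So every solution coincides near `0` with the series. -/

/-! ### Beta integrals -/

theorem integral_sub_rpow_mul_rpow {a b t : ℝ} (ha : 0 < a) (hb : 0 < b) (ht : 0 < t) :
    ∫ s in (0 : ℝ)..t, (t - s) ^ (a - 1) * s ^ (b - 1) =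
      Real.Gamma a * Real.Gamma b / Real.Gamma (a + b) * t ^ (a + b - 1) := by
  have h := Complex.betaIntegral_scaled (b : ℂ) (a : ℂ) ht
  rw [Complex.betaIntegral_eq_Gamma_mul_div _ _ (by simpa) (by simpa)] at h
  have h1 : ∫ x in (0 : ℝ)..t, (x : ℂ) ^ ((b : ℂ) - 1) * ((t : ℂ) - x) ^ ((a : ℂ) - 1) =
      ∫ x in (0 : ℝ)..t, (((t - x) ^ (a - 1) * x ^ (b - 1) : ℝ) : ℂ) := by
    refine intervalIntegral.integral_congr fun x hx => ?_
    rw [uIcc_of_le ht.le] at hx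
    have e1 : ((x ^ (b - 1) : ℝ) : ℂ) = (x : ℂ) ^ ((b : ℂ) - 1) := by
      rw [Complex.ofReal_cpow hx.1]; push_cast; rfl
    have e2 : (((t - x) ^ (a - 1) : ℝ) : ℂ) = ((t : ℂ) - x) ^ ((a : ℂ) - 1) := by
      rw [Complex.ofReal_cpow (sub_nonneg.2 hx.2)]; push_cast; rfl
    simp only [Complex.ofReal_mul]
    rw [e1, e2, mul_comm]
  rw [h1, intervalIntegral.integral_ofReal] at h
  have e3 : ((t ^ (a + b - 1) : ℝ) : ℂ) = (t : ℂ) ^ ((b : ℂ) + a - 1) := by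
    rw [Complex.ofReal_cpow ht.le]; push_cast; rw [add_comm (a : ℂ)]
  rw [← e3, ← Complex.ofReal_add, Complex.Gamma_ofReal, Complex.Gamma_ofReal,
    Complex.Gamma_ofReal] at h
  have h2 : ∫ s in (0 : ℝ)..t, (t - s) ^ (a - 1) * s ^ (b - 1) =
      t ^ (a + b - 1) * (Real.Gamma b * Real.Gamma a / Real.Gamma (b + a)) := by exact_mod_cast h
  rw [h2, add_comm b a]; ring

/-- A function that is not integrable has integral `0` by convention, and the Beta value is
positive. -/
theorem intervalIntegrable_sub_rpow_mul_rpow {a b t : ℝ} (ha : 0 < a) (hb : 0 < b) (ht : 0 < t) :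
    IntervalIntegrable (fun s => (t - s) ^ (a - 1) * s ^ (b - 1)) MeasureTheory.volume 0 t := by
  apply intervalIntegral.intervalIntegrable_of_integral_ne_zero
  rw [integral_sub_rpow_mul_rpow ha hb ht]
  have := Real.Gamma_pos_of_pos ha
  have := Real.Gamma_pos_of_pos hb
  have := Real.Gamma_pos_of_pos (add_pos ha hb)
  positivity

theorem integral_sub_rpow_mul_sub_rpow {a b r t : ℝ} (ha : 0 < a) (hb : 0 < b) (ht : r < t) :
    ∫ s in r..t, (t - s) ^ (a - 1) * (s - r) ^ (b - 1) =
      Real.Gamma a * Real.Gamma b / Real.Gamma (a + b) * (t - r) ^ (a + b - 1) := by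
  rw [← integral_sub_rpow_mul_rpow ha hb (sub_pos.2 ht)]
  have := intervalIntegral.integral_comp_sub_right (a := r) (b := t)
    (fun s : ℝ => ((t - r) - s) ^ (a - 1) * s ^ (b - 1)) r
  simpa using this

theorem intervalIntegrable_sub_rpow_mul_sub_rpow {a b r t : ℝ} (ha : 0 < a) (hb : 0 < b)
    (ht : r < t) :
    IntervalIntegrable (fun s => (t - s) ^ (a - 1) * (s - r) ^ (b - 1))
      MeasureTheory.volume r t := by
  apply intervalIntegral.intervalIntegrable_of_integral_ne_zero
  rw [integral_sub_rpow_mul_sub_rpow ha hb ht]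
  have := Real.Gamma_pos_of_pos ha
  have := Real.Gamma_pos_of_pos hb
  have := Real.Gamma_pos_of_pos (add_pos ha hb)
  have := sub_pos.2 ht
  positivity

theorem intervalIntegrable_sub_rpow {a t : ℝ} (ha : 0 < a) (ht : 0 ≤ t) :
    IntervalIntegrable (fun s => (t - s) ^ (a - 1)) MeasureTheory.volume 0 t := by
  rcases ht.eq_or_lt with rfl | ht
  · simp
  · simpa using intervalIntegrable_sub_rpow_mul_rpow ha one_pos ht

/-- `Γ(y) / Γ(y + θ)` is bounded by its value at `y = 1` for `y ≥ 1`. -/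
theorem Gamma_div_Gamma_add_le {y θ : ℝ} (hy : 1 ≤ y) (hθ : 0 < θ) :
    Real.Gamma y / Real.Gamma (y + θ) ≤ 1 / Real.Gamma (1 + θ) := by
  have hy0 : 0 < y := by linarith
  have h1 := integral_sub_rpow_mul_rpow hθ hy0 one_pos
  have h2 := integral_sub_rpow_mul_rpow hθ one_pos one_pos
  -- Both quotients are Beta integrals up to the factor `Γ(θ)`, and `s^(y-1) ≤ 1` on `[0, 1]`.
  have h3 : ∫ s in (0 : ℝ)..1, (1 - s) ^ (θ - 1) * s ^ (y - 1) ≤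
      ∫ s in (0 : ℝ)..1, (1 - s) ^ (θ - 1) * s ^ ((1 : ℝ) - 1) := by
    refine intervalIntegral.integral_mono_on zero_le_one
      (intervalIntegrable_sub_rpow_mul_rpow hθ hy0 one_pos)
      (intervalIntegrable_sub_rpow_mul_rpow hθ one_pos one_pos) fun x hx => ?_
    refine mul_le_mul_of_nonneg_left ?_ (Real.rpow_nonneg (sub_nonneg.2 hx.2) _)
    rw [sub_self, Real.rpow_zero]
    exact Real.rpow_le_one hx.1 hx.2 (by linarith)
  rw [h1, h2, Real.one_rpow, Real.one_rpow, mul_one, mul_one, Real.Gamma_one, mul_one,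
    mul_div_assoc, ← mul_one_div (Real.Gamma θ) (Real.Gamma (θ + 1))] at h3
  have := le_of_mul_le_mul_left h3 (Real.Gamma_pos_of_pos hθ)
  rwa [add_comm y, add_comm 1]

/-! ### Series under the fractional integral -/

/-- By Tonelli the sum of the norms has finite integral; hence the series converges almost
everywhere, which gives measurability of the sum, and its norm is dominated. -/
theorem MeasureTheory.integrable_tsum_of_summable_integral_norm {X E : Type*}
    [MeasurableSpace X] {μ : Measure X} [NormedAddCommGroup E] [CompleteSpace E]
    {F : ℕ → X → E} (hF : ∀ i, Integrable (F i) μ)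
    (hs : Summable fun i => ∫ a, ‖F i a‖ ∂μ) : Integrable (fun a => ∑' i, F i a) μ := by
  have hfin : ∑' i, ∫⁻ a, ‖F i a‖ₑ ∂μ ≠ ⊤ := by
    have : ∀ i, ∫⁻ a, ‖F i a‖ₑ ∂μ = ENNReal.ofReal (∫ a, ‖F i a‖ ∂μ) := fun i =>
      (ofReal_integral_norm_eq_lintegral_enorm (hF i)).symm
    simp_rw [this]
    rw [← ENNReal.ofReal_tsum_of_nonneg (fun i => integral_nonneg fun _ => norm_nonneg _) hs]
    exact ENNReal.ofReal_ne_top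
  have hae : ∀ᵐ a ∂μ, Summable fun i => ‖F i a‖ := by
    refine summable_norm_of_tsum_eLpNorm_ne_top le_rfl (fun i => (hF i).1) ?_
    simpa only [eLpNorm_one_eq_lintegral_enorm] using hfin
  refine ⟨?_, ?_⟩
  · refine aestronglyMeasurable_of_tendsto_ae Filter.atTop
      (f := fun n a => ∑ i ∈ Finset.range n, F i a)
      (fun n => Finset.aestronglyMeasurable_fun_sum _ fun i _ => (hF i).1) ?_
    filter_upwards [hae] with a ha
    exact ha.of_norm.hasSum.tendsto_sum_nat
  · refine lt_of_le_of_lt (lintegral_mono fun a => enorm_tsum_le_tsum_enorm) ?_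
    rw [lintegral_tsum fun i => (hF i).1.enorm]
    exact hfin.lt_top

theorem norm_rlIntegrand {α t s : ℝ} (g : ℝ → ℂ) (hs : s ≤ t) :
    ‖rlIntegrand α g t s‖ = (t - s) ^ (α - 1) * ‖g s‖ := by
  rw [rlIntegrand, norm_mul, Complex.norm_real, Real.norm_of_nonneg
    (Real.rpow_nonneg (sub_nonneg.2 hs) _)]

/-- Termwise Riemann-Liouville integration of a generalized power series. -/
theorem rlIntegral_tsum {α t : ℝ} (hα : 0 < α) (ht : 0 < t) {e : ℕ → ℂ} {β : ℕ → ℝ}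
    (hβ : ∀ k, 0 < β k)
    (hs : Summable fun k => ‖e k‖ *
      (Real.Gamma (β k) / Real.Gamma (α + β k) * t ^ (α + β k - 1))) :
    IntervalIntegrable (rlIntegrand α (fun s => ∑' k, e k * ((s ^ (β k - 1) : ℝ) : ℂ)) t)
        MeasureTheory.volume 0 t ∧
      HasSum (fun k => e k *
          ((Real.Gamma (β k) / Real.Gamma (α + β k) * t ^ (α + β k - 1) : ℝ) : ℂ))
        (rlIntegral α (fun s => ∑' k, e k * ((s ^ (β k - 1) : ℝ) : ℂ)) t) := by
  have hG := Real.Gamma_pos_of_pos hα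
  have hF : ∀ k s, rlIntegrand α (fun s => e k * ((s ^ (β k - 1) : ℝ) : ℂ)) t s =
      e k * (((t - s) ^ (α - 1) * s ^ (β k - 1) : ℝ) : ℂ) := fun k s => by
    simp only [rlIntegrand, Complex.ofReal_mul]; ring
  have hFn : ∀ k, ∀ s ∈ Ioc 0 t,
      ‖rlIntegrand α (fun s => e k * ((s ^ (β k - 1) : ℝ) : ℂ)) t s‖ =
        ‖e k‖ * ((t - s) ^ (α - 1) * s ^ (β k - 1)) := fun k s hs => by
    rw [hF, norm_mul, Complex.norm_real, Real.norm_of_nonneg]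
    exact mul_nonneg (Real.rpow_nonneg (sub_nonneg.2 hs.2) _) (Real.rpow_nonneg hs.1.le _)
  have hint : ∀ k, MeasureTheory.Integrable
      (rlIntegrand α (fun s => e k * ((s ^ (β k - 1) : ℝ) : ℂ)) t)
      (MeasureTheory.volume.restrict (Ioc 0 t)) := fun k => by
    have := intervalIntegrable_sub_rpow_mul_rpow hα (hβ k) ht
    rw [intervalIntegrable_iff_integrableOn_Ioc_of_le ht.le] at this
    refine ((MeasureTheory.Integrable.ofReal (𝕜 := ℂ) this).const_mul (e k)).congr (Filter.Eventually.of_forall fun s => ?_)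
    rw [hF]; rfl
  -- The kernel and the powers are nonnegative, so the hypothesis `hs` is exactly summability of the
  -- `L¹` norms, up to the factor `Γ(α)`.
  have hnorm : ∀ k, ∫ s in Ioc 0 t, ‖rlIntegrand α (fun s => e k * ((s ^ (β k - 1) : ℝ) : ℂ)) t s‖
      = Real.Gamma α * (‖e k‖ *
          (Real.Gamma (β k) / Real.Gamma (α + β k) * t ^ (α + β k - 1))) := fun k => by
    rw [MeasureTheory.setIntegral_congr_fun measurableSet_Ioc (hFn k),
      ← intervalIntegral.integral_of_le ht.le, intervalIntegral.integral_const_mul,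
      integral_sub_rpow_mul_rpow hα (hβ k) ht]
    ring
  have hval : ∀ k, ∫ s in Ioc 0 t, rlIntegrand α (fun s => e k * ((s ^ (β k - 1) : ℝ) : ℂ)) t s
      = (Real.Gamma α : ℂ) * (e k *
          ((Real.Gamma (β k) / Real.Gamma (α + β k) * t ^ (α + β k - 1) : ℝ) : ℂ)) := fun k => by
    simp_rw [hF]
    rw [← intervalIntegral.integral_of_le ht.le, intervalIntegral.integral_const_mul,
      intervalIntegral.integral_ofReal, integral_sub_rpow_mul_rpow hα (hβ k) ht]
    push_cast; ring
  have hsum : Summable fun k => ∫ s in Ioc 0 t,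
      ‖rlIntegrand α (fun s => e k * ((s ^ (β k - 1) : ℝ) : ℂ)) t s‖ := by
    simp_rw [hnorm]; exact hs.mul_left _
  have hts : ∀ s, rlIntegrand α (fun s => ∑' k, e k * ((s ^ (β k - 1) : ℝ) : ℂ)) t s =
      ∑' k, rlIntegrand α (fun s => e k * ((s ^ (β k - 1) : ℝ) : ℂ)) t s := fun s => by
    simp only [rlIntegrand, tsum_mul_left]
  constructor
  · rw [intervalIntegrable_iff_integrableOn_Ioc_of_le ht.le]
    exact (MeasureTheory.integrable_tsum_of_summable_integral_norm hint hsum).congr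
      (Filter.Eventually.of_forall fun s => (hts s).symm)
  · have h := (MeasureTheory.hasSum_integral_of_summable_integral_norm hint hsum).mul_left
      ((1 / Real.Gamma α : ℝ) : ℂ)
    simp_rw [hval, ← hts] at h
    rw [rlIntegral, intervalIntegral.integral_of_le ht.le]
    convert! h using 2 with k
    push_cast
    field_simp [Complex.ofReal_ne_zero.2 hG.ne']

theorem rlIntegral_congr {α t : ℝ} {g h : ℝ → ℂ} (ht : 0 ≤ t) (hgh : ∀ᵐ s, s ∈ Ioc 0 t → g s = h s) :
    rlIntegral α g t = rlIntegral α h t := by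
  unfold rlIntegral
  congr 1
  refine intervalIntegral.integral_congr_ae ?_
  rw [uIoc_of_le ht]
  filter_upwards [hgh] with s hs hst
  simp only [rlIntegrand, hs hst]

theorem intervalIntegrable_rlIntegrand_congr {α t : ℝ} {g h : ℝ → ℂ} (ht : 0 ≤ t)
    (hgh : ∀ᵐ s, s ∈ Ioc 0 t → g s = h s)
    (hg : IntervalIntegrable (rlIntegrand α g t) MeasureTheory.volume 0 t) :
    IntervalIntegrable (rlIntegrand α h t) MeasureTheory.volume 0 t := by
  refine hg.congr_ae ?_
  rw [uIoc_of_le ht, Filter.EventuallyEq, MeasureTheory.ae_restrict_iff' measurableSet_Ioc]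
  filter_upwards [hgh] with s hs hst
  simp only [rlIntegrand, hs hst]

/-! ### The semigroup law -/

/-- `I^α I^β h = I^(α + β) h` at every point where the right-hand side converges absolutely. -/
theorem rlIntegral_rlIntegral {α β t : ℝ} (hα : 0 < α) (hβ : 0 < β) (ht : 0 ≤ t) {h : ℝ → ℂ}
    (hh : IntervalIntegrable h MeasureTheory.volume 0 t)
    (hc : IntervalIntegrable (rlIntegrand (α + β) h t) MeasureTheory.volume 0 t) :
    rlIntegral α (rlIntegral β h) t = rlIntegral (α + β) h t := by
  set μ := (MeasureTheory.volume.restrict (Ioc 0 t) : MeasureTheory.Measure ℝ) with hμ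
  have hGα := Real.Gamma_pos_of_pos hα
  have hGβ := Real.Gamma_pos_of_pos hβ
  have hGαβ := Real.Gamma_pos_of_pos (add_pos hα hβ)
  let k : ℝ × ℝ → ℝ := fun z => if z.2 < z.1 then (t - z.1) ^ (α - 1) * (z.1 - z.2) ^ (β - 1) else 0
  have hkm : Measurable k := by
    refine Measurable.ite (measurableSet_lt measurable_snd measurable_fst) ?_ measurable_const
    fun_prop
  -- The point `r = t` is a genuine exception: the integral is `0` there, while the right-hand side
  -- is not if `α + β = 1`, since `0 ^ 0 = 1`. It is a null set.
  have hk_int : ∀ r ∈ Ioc 0 t, ∫ s, k (s, r) ∂μ =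
      Real.Gamma α * Real.Gamma β / Real.Gamma (α + β) * (t - r) ^ (α + β - 1) ∨ r = t := by
    intro r hr
    rcases hr.2.eq_or_lt with rfl | hrt
    · exact Or.inr rfl
    left
    rw [← integral_sub_rpow_mul_sub_rpow hα hβ hrt, intervalIntegral.integral_of_le hrt.le]
    have : (fun s => k (s, r)) = (Ioi r).indicator
        (fun s => (t - s) ^ (α - 1) * (s - r) ^ (β - 1)) := by
      funext s; simp [k, indicator]
    rw [this, MeasureTheory.integral_indicator measurableSet_Ioi, hμ,
      MeasureTheory.Measure.restrict_restrict measurableSet_Ioi]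
    congr 2
    ext s; simp only [mem_inter_iff, mem_Ioi, mem_Ioc]
    constructor
    · rintro ⟨h1, h2, h3⟩; exact ⟨h1, h3⟩
    · rintro ⟨h1, h3⟩; exact ⟨h1, hr.1.trans h1, h3⟩
  have hk_integrable : ∀ r ∈ Ioc 0 t, r < t → MeasureTheory.Integrable (fun s => k (s, r)) μ := by
    intro r hr hrt
    have h1 := intervalIntegrable_sub_rpow_mul_sub_rpow hα hβ hrt
    rw [intervalIntegrable_iff_integrableOn_Ioc_of_le hrt.le] at h1
    have : (fun s => k (s, r)) = (Ioi r).indicator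
        (fun s => (t - s) ^ (α - 1) * (s - r) ^ (β - 1)) := by
      funext s; simp [k, indicator]
    rw [this, MeasureTheory.integrable_indicator_iff measurableSet_Ioi, MeasureTheory.IntegrableOn,
      hμ, MeasureTheory.Measure.restrict_restrict measurableSet_Ioi]
    refine MeasureTheory.IntegrableOn.mono_set h1 ?_
    rintro s ⟨h1, h2, h3⟩; exact ⟨h1, h3⟩
  have hk_nonneg : ∀ s ∈ Ioc 0 t, ∀ r, 0 ≤ k (s, r) := by
    intro s hs r
    simp only [k]; split_ifs with h1
    · exact mul_nonneg (Real.rpow_nonneg (sub_nonneg.2 hs.2) _)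
        (Real.rpow_nonneg (sub_nonneg.2 h1.le) _)
    · exact le_rfl
  have hrne : ∀ᵐ r ∂μ, r ∈ Ioc 0 t ∧ r < t := by
    have h1 : ∀ᵐ r ∂(MeasureTheory.volume : MeasureTheory.Measure ℝ), r ≠ t := by
      simp [MeasureTheory.ae_iff, MeasureTheory.measure_singleton]
    rw [hμ, MeasureTheory.ae_restrict_iff' measurableSet_Ioc]
    filter_upwards [h1] with r hr hm
    exact ⟨hm, lt_of_le_of_ne hm.2 hr⟩
  have hmem : ∀ᵐ s ∂μ, s ∈ Ioc 0 t := MeasureTheory.ae_restrict_mem measurableSet_Ioc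
  rw [intervalIntegrable_iff_integrableOn_Ioc_of_le ht] at hh hc
  -- Fubini is licensed by integrating first in `s`: the inner integral of the norm is a multiple of
  -- the norm of the integrand in `hc`.
  have hK : MeasureTheory.Integrable (fun z : ℝ × ℝ => (k z : ℂ) * h z.2) (μ.prod μ) := by
    rw [MeasureTheory.integrable_prod_iff']
    · constructor
      · filter_upwards [hrne] with r hr
        exact ((hk_integrable r hr.1 hr.2).ofReal (𝕜 := ℂ)).mul_const _
      · refine (hc.norm.const_mul (Real.Gamma α * Real.Gamma β / Real.Gamma (α + β))).congr ?_
        filter_upwards [hrne] with r hr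
        have h1 := (hk_int r hr.1).resolve_right hr.2.ne
        have h2 : ∫ s, ‖(k (s, r) : ℂ) * h r‖ ∂μ = ∫ s, k (s, r) * ‖h r‖ ∂μ := by
          refine MeasureTheory.integral_congr_ae ?_
          filter_upwards [hmem] with s hs
          rw [norm_mul, Complex.norm_real, Real.norm_of_nonneg (hk_nonneg s hs r)]
        rw [h2, MeasureTheory.integral_mul_const, h1, norm_rlIntegrand _ hr.2.le]
        ring
    · exact (Complex.measurable_ofReal.comp hkm).aestronglyMeasurable.mul
        hh.aestronglyMeasurable.comp_snd
  have hswap := MeasureTheory.integral_integral_swap (f := fun s r => (k (s, r) : ℂ) * h r) hK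
  have hL : ∫ s, ∫ r, (k (s, r) : ℂ) * h r ∂μ ∂μ =
      (Real.Gamma β : ℂ) * ∫ s in (0 : ℝ)..t, rlIntegrand α (rlIntegral β h) t s := by
    rw [intervalIntegral.integral_of_le ht, ← MeasureTheory.integral_const_mul]
    refine MeasureTheory.setIntegral_congr_fun measurableSet_Ioc fun s hs => ?_
    have h1 : (fun r => (k (s, r) : ℂ) * h r) = (Iio s).indicator
        (fun r => (((t - s) ^ (α - 1) : ℝ) : ℂ) * rlIntegrand β h s r) := by
      funext r
      simp only [k, indicator, mem_Iio, rlIntegrand]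
      split_ifs
      · push_cast; ring
      · simp
    simp only [rlIntegrand, rlIntegral]
    rw [h1, MeasureTheory.integral_indicator measurableSet_Iio, hμ,
      MeasureTheory.Measure.restrict_restrict measurableSet_Iio,
      MeasureTheory.integral_const_mul, intervalIntegral.integral_of_le hs.1.le,
      MeasureTheory.integral_Ioc_eq_integral_Ioo]
    have h2 : Iio s ∩ Ioc 0 t = Ioo 0 s := by
      ext r; simp only [mem_inter_iff, mem_Iio, mem_Ioc, mem_Ioo]
      constructor
      · rintro ⟨h1, h2, h3⟩; exact ⟨h2, h1⟩
      · rintro ⟨h1, h2⟩; exact ⟨h2, h1, h2.le.trans hs.2⟩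
    rw [h2]
    simp only [rlIntegrand]
    push_cast
    field_simp [Complex.ofReal_ne_zero.2 hGβ.ne']
  have hR : ∫ r, ∫ s, (k (s, r) : ℂ) * h r ∂μ ∂μ =
      ((Real.Gamma α * Real.Gamma β / Real.Gamma (α + β) : ℝ) : ℂ) *
        ∫ s in (0 : ℝ)..t, rlIntegrand (α + β) h t s := by
    rw [intervalIntegral.integral_of_le ht, ← MeasureTheory.integral_const_mul]
    refine MeasureTheory.integral_congr_ae ?_
    filter_upwards [hrne] with r hr
    rw [MeasureTheory.integral_mul_const, integral_complex_ofReal,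
      (hk_int r hr.1).resolve_right hr.2.ne, rlIntegrand]
    push_cast; ring
  rw [hL, hR] at hswap
  have hβ0 := Complex.ofReal_ne_zero.2 hGβ.ne'
  have hα0 := Complex.ofReal_ne_zero.2 hGα.ne'
  have hαβ0 := Complex.ofReal_ne_zero.2 hGαβ.ne'
  unfold rlIntegral at hswap ⊢
  push_cast at hswap ⊢
  field_simp at hswap ⊢
  linear_combination hswap

/-! ### Absolutely continuous complex-valued functions -/

theorem AbsolutelyContinuousOnInterval.of_dist_le {X Y : Type*} [PseudoMetricSpace X]
    [PseudoMetricSpace Y] {f : ℝ → X} {g : ℝ → Y} {a b : ℝ}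
    (hf : AbsolutelyContinuousOnInterval f a b) (h : ∀ x y, dist (g x) (g y) ≤ dist (f x) (f y)) :
    AbsolutelyContinuousOnInterval g a b :=
  squeeze_zero (fun _ => Finset.sum_nonneg fun _ _ => dist_nonneg)
    (fun _ => Finset.sum_le_sum fun _ _ => h _ _) hf

theorem AbsolutelyContinuousOnInterval.re {f : ℝ → ℂ} {a b : ℝ}
    (hf : AbsolutelyContinuousOnInterval f a b) :
    AbsolutelyContinuousOnInterval (fun x => (f x).re) a b :=
  hf.of_dist_le fun x y => by
    rw [Real.dist_eq, dist_eq_norm, ← Complex.sub_re]; exact Complex.abs_re_le_norm _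

theorem AbsolutelyContinuousOnInterval.im {f : ℝ → ℂ} {a b : ℝ}
    (hf : AbsolutelyContinuousOnInterval f a b) :
    AbsolutelyContinuousOnInterval (fun x => (f x).im) a b :=
  hf.of_dist_le fun x y => by
    rw [Real.dist_eq, dist_eq_norm, ← Complex.sub_im]; exact Complex.abs_im_le_norm _

theorem absolutelyContinuousOnInterval_of_re_im {f : ℝ → ℂ} {a b : ℝ}
    (hr : AbsolutelyContinuousOnInterval (fun x => (f x).re) a b)
    (hi : AbsolutelyContinuousOnInterval (fun x => (f x).im) a b) :
    AbsolutelyContinuousOnInterval f a b := by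
  have h := Filter.Tendsto.add hr hi
  rw [add_zero] at h
  refine squeeze_zero (fun _ => Finset.sum_nonneg fun _ _ => dist_nonneg) (fun E => ?_) h
  rw [← Finset.sum_add_distrib]
  refine Finset.sum_le_sum fun i _ => ?_
  rw [Real.dist_eq, Real.dist_eq, dist_eq_norm, ← Complex.sub_re, ← Complex.sub_im]
  exact Complex.norm_le_abs_re_add_abs_im _

/-- Real and imaginary parts commute with the integral, which reduces the claim to real-valued
primitives. -/
theorem absolutelyContinuousOnInterval_integral {g : ℝ → ℂ} {S : ℝ}
    (hg : IntervalIntegrable g MeasureTheory.volume 0 S) :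
    AbsolutelyContinuousOnInterval (fun x => ∫ s in (0 : ℝ)..x, g s) 0 S := by
  have hmono : ∀ x ∈ uIcc 0 S, IntervalIntegrable g MeasureTheory.volume 0 x := fun x hx =>
    hg.mono_set (uIcc_subset_uIcc_left hx)
  have key : ∀ L : ℂ →L[ℝ] ℝ, AbsolutelyContinuousOnInterval
      (fun x => L (∫ s in (0 : ℝ)..x, g s)) 0 S := fun L => by
    have h1 : IntervalIntegrable (fun s => L (g s)) MeasureTheory.volume 0 S :=
      ⟨L.integrable_comp hg.1, L.integrable_comp hg.2⟩
    have h2 := h1.absolutelyContinuousOnInterval_intervalIntegral (c := 0) left_mem_uIcc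
    rw [absolutelyContinuousOnInterval_iff] at h2 ⊢
    intro ε hε
    obtain ⟨δ, hδ, hE⟩ := h2 ε hε
    refine ⟨δ, hδ, fun E hE1 hE2 => ?_⟩
    refine lt_of_eq_of_lt (Finset.sum_congr rfl fun i hi => ?_) (hE E hE1 hE2)
    rw [L.intervalIntegral_comp_comm (hmono _ (hE1.1 i hi).1),
      L.intervalIntegral_comp_comm (hmono _ (hE1.1 i hi).2)]
  exact absolutelyContinuousOnInterval_of_re_im (key Complex.reCLM) (key Complex.imCLM)

theorem AbsolutelyContinuousOnInterval.add_const {f : ℝ → ℂ} {a b : ℝ} (c : ℂ)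
    (hf : AbsolutelyContinuousOnInterval f a b) :
    AbsolutelyContinuousOnInterval (fun x => c + f x) a b :=
  hf.of_dist_le fun x y => by simp

theorem AbsolutelyContinuousOnInterval.congr_Icc {f g : ℝ → ℂ} {S : ℝ} (hS : 0 ≤ S)
    (hf : AbsolutelyContinuousOnInterval f 0 S) (h : EqOn g f (Icc 0 S)) :
    AbsolutelyContinuousOnInterval g 0 S := by
  rw [absolutelyContinuousOnInterval_iff] at hf ⊢
  intro ε hε
  obtain ⟨δ, hδ, hE⟩ := hf ε hε
  refine ⟨δ, hδ, fun E hE1 hE2 => ?_⟩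
  refine lt_of_eq_of_lt (Finset.sum_congr rfl fun i hi => ?_) (hE E hE1 hE2)
  have h1 := (hE1.1 i hi).1
  have h2 := (hE1.1 i hi).2
  rw [uIcc_of_le hS] at h1 h2
  rw [h h1, h h2]

theorem ae_ne_real (a : ℝ) : ∀ᵐ x : ℝ, x ≠ a := by
  simp [MeasureTheory.ae_iff, MeasureTheory.measure_singleton]

/-- The fundamental theorem of calculus for absolutely continuous complex-valued functions. -/
theorem AbsolutelyContinuousOnInterval.eq_add_integral_derivWithin {f : ℝ → ℂ} {S : ℝ}
    (hS : 0 < S) (hf : AbsolutelyContinuousOnInterval f 0 S) :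
    IntervalIntegrable (derivWithin f (Icc 0 S)) MeasureTheory.volume 0 S ∧
      ∀ t ∈ Icc 0 S, f t = f 0 + ∫ s in (0 : ℝ)..t, derivWithin f (Icc 0 S) s := by
  set u := fun x => (f x).re with hu
  set w := fun x => (f x).im with hw
  have hd : ∀ᵐ x, x ∈ Ioc 0 S →
      ((deriv u x : ℝ) : ℂ) + ((deriv w x : ℝ) : ℂ) * Complex.I = derivWithin f (Icc 0 S) x := by
    filter_upwards [hf.re.ae_differentiableAt, hf.im.ae_differentiableAt, ae_ne_real S]
      with x hx1 hx2 hxS hx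
    have hxI : x ∈ uIcc 0 S := by rw [uIcc_of_le hS.le]; exact ⟨hx.1.le, hx.2⟩
    have h1 := (hx1 hxI).hasDerivAt.ofReal_comp
    have h2 := ((hx2 hxI).hasDerivAt.ofReal_comp).mul_const Complex.I
    have h3 := h1.add h2
    have h4 : (fun y : ℝ => ((u y : ℝ) : ℂ)) + (fun y : ℝ => ((w y : ℝ) : ℂ) * Complex.I) = f := by
      funext y; exact Complex.re_add_im (f y)
    have h5 : HasDerivAt f (((deriv u x : ℝ) : ℂ) + ((deriv w x : ℝ) : ℂ) * Complex.I) x := by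
      rw [← h4]; exact h3
    rw [derivWithin_of_mem_nhds (Icc_mem_nhds hx.1 (lt_of_le_of_ne hx.2 hxS)), h5.deriv]
  have hiu := hf.re.intervalIntegrable_deriv
  have hiw := hf.im.intervalIntegrable_deriv
  have hcu : IntervalIntegrable (fun x => ((deriv u x : ℝ) : ℂ)) MeasureTheory.volume 0 S :=
    ⟨MeasureTheory.Integrable.ofReal hiu.1, MeasureTheory.Integrable.ofReal hiu.2⟩
  have hcw : IntervalIntegrable (fun x => ((deriv w x : ℝ) : ℂ) * Complex.I)
      MeasureTheory.volume 0 S :=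
    IntervalIntegrable.mul_const
      ⟨MeasureTheory.Integrable.ofReal hiw.1, MeasureTheory.Integrable.ofReal hiw.2⟩ _
  refine ⟨(hcu.add hcw).congr_ae ?_, fun t ht => ?_⟩
  · rw [uIoc_of_le hS.le, Filter.EventuallyEq, MeasureTheory.ae_restrict_iff' measurableSet_Ioc]
    exact hd
  · have hsub : uIcc 0 t ⊆ uIcc 0 S := by
      rw [uIcc_of_le ht.1, uIcc_of_le hS.le]; exact Icc_subset_Icc_right ht.2
    have hint : ∫ s in (0 : ℝ)..t, derivWithin f (Icc 0 S) s =
        ∫ s in (0 : ℝ)..t, (((deriv u s : ℝ) : ℂ) + ((deriv w s : ℝ) : ℂ) * Complex.I) := by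
      refine intervalIntegral.integral_congr_ae ?_
      rw [uIoc_of_le ht.1]
      filter_upwards [hd] with x hx hxt
      exact (hx ⟨hxt.1, hxt.2.trans ht.2⟩).symm
    rw [hint, intervalIntegral.integral_add (hcu.mono_set hsub) (hcw.mono_set hsub),
      intervalIntegral.integral_mul_const, intervalIntegral.integral_ofReal,
      intervalIntegral.integral_ofReal, (hf.re.mono hsub).integral_deriv_eq_sub,
      (hf.im.mono hsub).integral_deriv_eq_sub]
    apply Complex.ext <;> simp

/-! ### Taylor's formula with a fractional-integral remainder -/

theorem rlIntegral_one (g : ℝ → ℂ) (t : ℝ) : rlIntegral 1 g t = ∫ s in (0 : ℝ)..t, g s := by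
  simp [rlIntegral, rlIntegrand]

theorem intervalIntegrable_rlIntegrand_of_one_le {α t : ℝ} (hα : 1 ≤ α) {g : ℝ → ℂ}
    (hg : IntervalIntegrable g MeasureTheory.volume 0 t) :
    IntervalIntegrable (rlIntegrand α g t) MeasureTheory.volume 0 t := by
  refine hg.continuousOn_mul (Continuous.continuousOn ?_)
  exact Complex.continuous_ofReal.comp
    ((continuous_const.sub continuous_id).rpow_const fun _ => Or.inr (by linarith))

theorem continuousOn_of_eq_add_integral {f g : ℝ → ℂ} {S : ℝ} (hS : 0 ≤ S)
    (hg : IntervalIntegrable g MeasureTheory.volume 0 S)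
    (h : ∀ t ∈ Icc 0 S, f t = f 0 + ∫ s in (0 : ℝ)..t, g s) : ContinuousOn f (Icc 0 S) := by
  have := intervalIntegral.continuousOn_primitive_interval
    (((intervalIntegrable_iff_integrableOn_Icc_of_le hS).1 hg).mono_set (uIcc_of_le hS).subset)
  rw [uIcc_of_le hS] at this
  exact (continuousOn_const.add this).congr h

/-- Descend from the top: a primitive of an integrable function is continuous, hence integrable. -/
theorem intervalIntegrable_chain {F : ℕ → ℝ → ℂ} {m : ℕ} {S : ℝ} (hS : 0 ≤ S)
    (hm : IntervalIntegrable (F m) MeasureTheory.volume 0 S)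
    (hF : ∀ k < m, ∀ t ∈ Icc 0 S, F k t = F k 0 + ∫ s in (0 : ℝ)..t, F (k + 1) s) :
    ∀ i ≤ m, IntervalIntegrable (F (m - i)) MeasureTheory.volume 0 S := by
  intro i
  induction i with
  | zero => intro _; simpa using hm
  | succ i ih =>
    intro hi
    have h1 := ih (by omega)
    have h2 := hF (m - (i + 1)) (by omega)
    rw [show m - (i + 1) + 1 = m - i by omega] at h2
    have h3 := continuousOn_of_eq_add_integral hS h1 h2
    rw [← uIcc_of_le hS] at h3
    exact h3.intervalIntegrable

theorem integral_taylor_term (l : ℕ) (c : ℂ) (t : ℝ) :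
    ∫ s in (0 : ℝ)..t, c / (l.factorial : ℂ) * (s : ℂ) ^ l =
      c / ((l + 1).factorial : ℂ) * (t : ℂ) ^ (l + 1) := by
  rw [intervalIntegral.integral_const_mul]
  have : ∫ s in (0 : ℝ)..t, (s : ℂ) ^ l = ((∫ s in (0 : ℝ)..t, s ^ l : ℝ) : ℂ) := by
    rw [← intervalIntegral.integral_ofReal]; simp
  rw [this, integral_pow, Nat.factorial_succ]
  have h1 : ((l : ℂ) + 1) ≠ 0 := by exact_mod_cast Nat.succ_ne_zero l
  have h2 : (l.factorial : ℂ) ≠ 0 := by exact_mod_cast l.factorial_ne_zero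
  push_cast
  field_simp
  simp

/-- Taylor's formula for a chain of successive primitives. -/
theorem taylor_rlIntegral {m : ℕ} {S : ℝ} (hS : 0 ≤ S) : ∀ F : ℕ → ℝ → ℂ,
    IntervalIntegrable (F (m + 1)) MeasureTheory.volume 0 S →
    (∀ k < m + 1, ∀ t ∈ Icc 0 S, F k t = F k 0 + ∫ s in (0 : ℝ)..t, F (k + 1) s) →
    ∀ t ∈ Icc 0 S, F 0 t = ∑ l ∈ Finset.range (m + 1), F l 0 / (l.factorial : ℂ) * (t : ℂ) ^ l +
      rlIntegral ((m + 1 : ℕ) : ℝ) (F (m + 1)) t := by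
  induction m with
  | zero =>
    intro F _ hF t ht
    have := hF 0 (by norm_num) t ht
    simpa [rlIntegral_one] using this
  | succ m ih =>
    intro F hm hF t ht
    -- The shifted chain expands `F 1`. Integrating once raises each Taylor term by one degree, and
    -- the remainder is handled by `I^1 I^(m+1) = I^(m+2)`.
    have h1 := ih (fun k => F (k + 1)) hm fun k hk => hF (k + 1) (by omega)
    have hsub : uIcc 0 t ⊆ uIcc 0 S := by
      rw [uIcc_of_le ht.1, uIcc_of_le hS]; exact Icc_subset_Icc_right ht.2
    have hmt := hm.mono_set hsub
    have hF1 : IntervalIntegrable (F 1) MeasureTheory.volume 0 t := by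
      have := (intervalIntegrable_chain hS hm hF (m + 1) (by omega)).mono_set hsub
      rwa [show m + 1 + 1 - (m + 1) = 1 by omega] at this
    have hterm : ∀ l ∈ Finset.range (m + 1), IntervalIntegrable
        (fun s : ℝ => F (l + 1) 0 / (l.factorial : ℂ) * (s : ℂ) ^ l) MeasureTheory.volume 0 t :=
      fun l _ => Continuous.intervalIntegrable (by fun_prop) _ _
    have hpoly : IntervalIntegrable
        (fun s : ℝ => ∑ l ∈ Finset.range (m + 1), F (l + 1) 0 / (l.factorial : ℂ) * (s : ℂ) ^ l)
        MeasureTheory.volume 0 t := Continuous.intervalIntegrable (by fun_prop) _ _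
    have hrl : ∀ s ∈ Icc 0 t, F 1 s - ∑ l ∈ Finset.range (m + 1),
        F (l + 1) 0 / (l.factorial : ℂ) * (s : ℂ) ^ l =
          rlIntegral ((m + 1 : ℕ) : ℝ) (F (m + 1 + 1)) s := fun s hs => by
      have := h1 s ⟨hs.1, hs.2.trans ht.2⟩
      simp only [zero_add] at this
      rw [this]; ring
    have h2 : ∫ s in (0 : ℝ)..t, rlIntegral ((m + 1 : ℕ) : ℝ) (F (m + 1 + 1)) s =
        (∫ s in (0 : ℝ)..t, F 1 s) - ∑ l ∈ Finset.range (m + 1),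
          F (l + 1) 0 / ((l + 1).factorial : ℂ) * (t : ℂ) ^ (l + 1) := by
      have e : ∀ l ∈ Finset.range (m + 1),
          F (l + 1) 0 / ((l + 1).factorial : ℂ) * (t : ℂ) ^ (l + 1) =
          ∫ s in (0 : ℝ)..t, F (l + 1) 0 / (l.factorial : ℂ) * (s : ℂ) ^ l := fun l _ =>
        (integral_taylor_term l _ t).symm
      rw [Finset.sum_congr rfl e, ← intervalIntegral.integral_finsetSum hterm,
        ← intervalIntegral.integral_sub hF1 hpoly]
      refine intervalIntegral.integral_congr fun s hs => ?_
      rw [uIcc_of_le ht.1] at hs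
      exact (hrl s hs).symm
    rw [← rlIntegral_one, rlIntegral_rlIntegral one_pos (by positivity) ht.1 hmt
      (intervalIntegrable_rlIntegrand_of_one_le (by push_cast; linarith) hmt)] at h2
    rw [hF 0 (by omega) t ht, Finset.sum_range_succ']
    rw [show (((m + 1 + 1 : ℕ) : ℕ) : ℝ) = 1 + ((m + 1 : ℕ) : ℝ) by push_cast; ring, h2]
    simp only [Nat.factorial_zero, Nat.cast_one, div_one, pow_zero, mul_one]
    ring

/-! ### The class `AC^m` and chains of primitives -/

/-- The derivatives below the top one are `C¹`, hence absolutely continuous; the top one is so by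
assumption. The fundamental theorem then applies at every level. -/
theorem IsACDiffOn.chain {m : ℕ} {S : ℝ} (hS : 0 < S) {v : ℝ → ℂ} (hv : IsACDiffOn (m + 1) S v) :
    IntervalIntegrable (iteratedDerivWithin (m + 1) v (Icc 0 S)) MeasureTheory.volume 0 S ∧
      ∀ k < m + 1, ∀ t ∈ Icc 0 S, iteratedDerivWithin k v (Icc 0 S) t =
        iteratedDerivWithin k v (Icc 0 S) 0 +
          ∫ s in (0 : ℝ)..t, iteratedDerivWithin (k + 1) v (Icc 0 S) s := by
  obtain ⟨h1, h2⟩ := hv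
  rw [Nat.add_sub_cancel] at h1 h2
  have hU := uniqueDiffOn_Icc hS
  have hAC : ∀ k < m + 1,
      AbsolutelyContinuousOnInterval (iteratedDerivWithin k v (Icc 0 S)) 0 S := by
    intro k hk
    rcases (Nat.lt_succ_iff.1 hk).eq_or_lt with rfl | hk
    · exact h2
    · have h3 : ContDiffOn ℝ ((k + 1 : ℕ) : WithTop ℕ∞) v (Icc 0 S) := h1.of_le (by exact_mod_cast hk)
      have h4 := ((contDiffOn_nat_succ_iff_contDiffOn_one_iteratedDerivWithin hU).1 h3).2
      rw [← uIcc_of_le hS.le] at h4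
      have h5 := h4.absolutelyContinuousOnInterval
      rwa [uIcc_of_le hS.le] at h5
  have hsucc : ∀ k, iteratedDerivWithin (k + 1) v (Icc 0 S) =
      derivWithin (iteratedDerivWithin k v (Icc 0 S)) (Icc 0 S) := fun k => by
    rw [iteratedDerivWithin_succ]
  constructor
  · rw [hsucc]; exact ((hAC m (by omega)).eq_add_integral_derivWithin hS).1
  · intro k hk t ht
    rw [hsucc]; exact ((hAC k hk).eq_add_integral_derivWithin hS).2 t ht

theorem hasDerivWithinAt_of_eq_add_integral {f g : ℝ → ℂ} {S : ℝ} (hg : ContinuousOn g (Icc 0 S))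
    (h : ∀ t ∈ Icc 0 S, f t = f 0 + ∫ s in (0 : ℝ)..t, g s) {t : ℝ} (ht : t ∈ Icc 0 S) :
    HasDerivWithinAt f (g t) (Icc 0 S) t := by
  have : Fact (t ∈ Icc 0 S) := ⟨ht⟩
  have hsub : uIcc 0 t ⊆ Icc 0 S := by
    rw [uIcc_of_le ht.1]; exact Icc_subset_Icc_right ht.2
  have h1 := intervalIntegral.integral_hasDerivWithinAt_right (s := Icc 0 S) (t := Icc 0 S)
    (hg.mono hsub).intervalIntegrable
    (hg.stronglyMeasurableAtFilter_nhdsWithin measurableSet_Icc t) (hg t ht)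
  exact (h1.const_add (f 0)).congr h (h t ht)

theorem iteratedDerivWithin_chain {m : ℕ} {S : ℝ} (hS : 0 < S) {F : ℕ → ℝ → ℂ}
    (hm : IntervalIntegrable (F (m + 1)) MeasureTheory.volume 0 S)
    (hF : ∀ k < m + 1, ∀ t ∈ Icc 0 S, F k t = F k 0 + ∫ s in (0 : ℝ)..t, F (k + 1) s) :
    ∀ k < m + 1, EqOn (iteratedDerivWithin k (F 0) (Icc 0 S)) (F k) (Icc 0 S) := by
  have hU := uniqueDiffOn_Icc hS
  have hcont : ∀ k < m + 1, ContinuousOn (F k) (Icc 0 S) := fun k hk => by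
    have := intervalIntegrable_chain hS.le hm hF (m - k) (by omega)
    rw [show m + 1 - (m - k) = k + 1 by omega] at this
    exact continuousOn_of_eq_add_integral hS.le this (hF k hk)
  intro k
  induction k with
  | zero => intro _ x _; simp
  | succ k ih =>
    intro hk x hx
    rw [iteratedDerivWithin_succ, derivWithin_congr (ih (by omega)) (ih (by omega) hx)]
    exact (hasDerivWithinAt_of_eq_add_integral (hcont (k + 1) hk) (hF k (by omega)) hx).derivWithin
      (hU x hx)

/-- Converse to `IsACDiffOn.chain`. The last function of the chain is merely integrable, so Lebesgue
differentiation recovers it only almost everywhere, which suffices under an integral. -/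
theorem isACDiffOn_chain {m : ℕ} {S : ℝ} (hS : 0 < S) {F : ℕ → ℝ → ℂ}
    (hm : IntervalIntegrable (F (m + 1)) MeasureTheory.volume 0 S)
    (hF : ∀ k < m + 1, ∀ t ∈ Icc 0 S, F k t = F k 0 + ∫ s in (0 : ℝ)..t, F (k + 1) s) :
    IsACDiffOn (m + 1) S (F 0) ∧
      ∀ᵐ x, x ∈ Ioc 0 S → iteratedDerivWithin (m + 1) (F 0) (Icc 0 S) x = F (m + 1) x := by
  have hU := uniqueDiffOn_Icc hS
  have hiter := iteratedDerivWithin_chain hS hm hF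
  have hcont : ∀ k < m + 1, ContinuousOn (F k) (Icc 0 S) := fun k hk => by
    have := intervalIntegrable_chain hS.le hm hF (m - k) (by omega)
    rw [show m + 1 - (m - k) = k + 1 by omega] at this
    exact continuousOn_of_eq_add_integral hS.le this (hF k hk)
  refine ⟨⟨?_, ?_⟩, ?_⟩
  · rw [Nat.add_sub_cancel, contDiffOn_nat_iff_continuousOn_differentiableOn_deriv hU]
    constructor
    · intro k hk
      exact (hcont k (by omega)).congr (hiter k (by omega))
    · intro k hk x hx
      exact ((hasDerivWithinAt_of_eq_add_integral (hcont (k + 1) (by omega))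
        (hF k (by omega)) hx).differentiableWithinAt).congr (hiter k (by omega))
          (hiter k (by omega) hx)
  · rw [Nat.add_sub_cancel]
    exact ((absolutelyContinuousOnInterval_integral hm).add_const (F m 0)).congr_Icc hS.le
      fun x hx => (hiter m (by omega) hx).trans (hF m (by omega) x hx)
  · filter_upwards [hm.ae_hasDerivAt_integral, ae_ne_real S] with x hx hxS hxm
    have hlt := lt_of_le_of_ne hxm.2 hxS
    have hxI : x ∈ Icc 0 S := ⟨hxm.1.le, hxm.2⟩
    have h1 := hx (by rwa [uIcc_of_le hS.le]) 0 left_mem_uIcc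
    have h2 : HasDerivWithinAt (F m) (F (m + 1) x) (Icc 0 S) x :=
      (h1.hasDerivWithinAt.const_add (F m 0)).congr (hF m (by omega)) (hF m (by omega) x hxI)
    rw [iteratedDerivWithin_succ, derivWithin_congr (hiter m (by omega)) (hiter m (by omega) hxI)]
    exact h2.derivWithin (hU x hxI)

/-! ### The equivalent Volterra equation and uniqueness -/

/-- A function with Caputo derivative `g` satisfies the corresponding Volterra equation. -/
theorem eq_add_rlIntegral_of_hasCaputoDerivAt {S θ : ℝ} (hS : 0 < S) (hθ : 0 < θ)
    (hlt : θ < ⌈θ⌉₊) {v g : ℝ → ℂ} (hv : IsACDiffOn ⌈θ⌉₊ S v)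
    (hg : ∀ t ∈ Ioc 0 S, HasCaputoDerivAt S θ v (g t) t) :
    ∀ t ∈ Icc 0 S, v t = ∑ l ∈ Finset.range ⌈θ⌉₊,
      iteratedDerivWithin l v (Icc 0 S) 0 / (l.factorial : ℂ) * (t : ℂ) ^ l +
        rlIntegral θ g t := by
  obtain ⟨m, hm⟩ : ∃ m, ⌈θ⌉₊ = m + 1 := Nat.exists_eq_succ_of_ne_zero (Nat.ceil_pos.2 hθ).ne'
  unfold HasCaputoDerivAt at hg
  rw [hm] at hv hg hlt ⊢
  intro t ht
  obtain ⟨h1, h2⟩ := hv.chain hS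
  have h3 := taylor_rlIntegral hS.le (fun k => iteratedDerivWithin k v (Icc 0 S)) h1 h2 t ht
  simp only [iteratedDerivWithin_zero] at h3
  rw [h3]
  congr 1
  have hsub : uIcc 0 t ⊆ uIcc 0 S := by
    rw [uIcc_of_le ht.1, uIcc_of_le hS.le]; exact Icc_subset_Icc_right ht.2
  -- `I^θ I^(⌈θ⌉-θ) = I^⌈θ⌉` turns the Taylor remainder into `I^θ` of the Caputo derivative. As `⌈θ⌉
  -- ≥ 1`, integrability of the top derivative is enough.
  have h4 := rlIntegral_rlIntegral hθ (sub_pos.2 hlt) ht.1 (h1.mono_set hsub)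
    (intervalIntegrable_rlIntegrand_of_one_le (by push_cast; linarith) (h1.mono_set hsub))
  rw [add_sub_cancel] at h4
  rw [← h4]
  refine rlIntegral_congr ht.1 (Filter.Eventually.of_forall fun s hs => ?_)
  exact (hg s ⟨hs.1, hs.2.trans ht.2⟩).2

/-- Substituting `u = t - s` pulls out `exp (l t)`; extending what remains to the half-line gives a
Gamma integral. -/
theorem integral_sub_rpow_mul_exp_le {θ l t : ℝ} (hθ : 0 < θ) (hl : 0 < l) (ht : 0 ≤ t) :
    ∫ s in (0 : ℝ)..t, (t - s) ^ (θ - 1) * Real.exp (l * s) ≤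
      Real.Gamma θ * (1 / l) ^ θ * Real.exp (l * t) := by
  have h1 := Real.integral_rpow_mul_exp_neg_mul_Ioi hθ hl
  have hint : MeasureTheory.IntegrableOn (fun u : ℝ => u ^ (θ - 1) * Real.exp (-(l * u))) (Ioi 0) := by
    by_contra hcon
    rw [MeasureTheory.integral_undef hcon] at h1
    have := Real.Gamma_pos_of_pos hθ
    have : 0 < (1 / l) ^ θ * Real.Gamma θ := by positivity
    linarith
  have h2 : ∫ s in (0 : ℝ)..t, (t - s) ^ (θ - 1) * Real.exp (l * s) =
      Real.exp (l * t) * ∫ u in (0 : ℝ)..t, u ^ (θ - 1) * Real.exp (-(l * u)) := by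
    rw [← intervalIntegral.integral_const_mul]
    have := intervalIntegral.integral_comp_sub_left (a := 0) (b := t)
      (fun u : ℝ => Real.exp (l * t) * (u ^ (θ - 1) * Real.exp (-(l * u)))) t
    rw [sub_self, sub_zero] at this
    rw [← this]
    refine intervalIntegral.integral_congr fun s _ => ?_
    have : Real.exp (l * s) = Real.exp (l * t) * Real.exp (-(l * (t - s))) := by
      rw [← Real.exp_add]; congr 1; ring
    simp only [this]; ring
  have h3 : ∫ u in (0 : ℝ)..t, u ^ (θ - 1) * Real.exp (-(l * u)) ≤ (1 / l) ^ θ * Real.Gamma θ := by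
    rw [← h1, intervalIntegral.integral_of_le ht]
    refine MeasureTheory.setIntegral_mono_set hint ?_ (Filter.Eventually.of_forall Ioc_subset_Ioi_self)
    filter_upwards [MeasureTheory.ae_restrict_mem measurableSet_Ioi] with u hu
    have : (0 : ℝ) < u := hu
    simp only [Pi.zero_apply]
    positivity
  rw [h2]
  calc _ ≤ Real.exp (l * t) * ((1 / l) ^ θ * Real.Gamma θ) :=
        mul_le_mul_of_nonneg_left h3 (Real.exp_pos _).le
    _ = _ := by ring

/-- In the norm `sup ‖g(s)‖ e^(-ls)` the operator `I^θ` has norm at most `l^(-θ)`, whatever the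
length of the interval; large `l` makes it a contraction. -/
theorem norm_rlIntegral_le_exp {θ l t C : ℝ} (hθ : 0 < θ) (hl : 0 < l) (ht : 0 ≤ t) (hC : 0 ≤ C)
    {g : ℝ → ℂ} (hg : ∀ s ∈ Icc 0 t, ‖g s‖ ≤ C * Real.exp (l * s)) :
    ‖rlIntegral θ g t‖ ≤ C * (1 / l) ^ θ * Real.exp (l * t) := by
  have hG := Real.Gamma_pos_of_pos hθ
  have h1 : ‖∫ s in (0 : ℝ)..t, rlIntegrand θ g t s‖ ≤
      ∫ s in (0 : ℝ)..t, C * ((t - s) ^ (θ - 1) * Real.exp (l * s)) := by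
    refine intervalIntegral.norm_integral_le_of_norm_le ht
      (Filter.Eventually.of_forall fun s hs => ?_)
      (((intervalIntegrable_sub_rpow hθ ht).mul_continuousOn (by fun_prop)).const_mul C)
    rw [norm_rlIntegrand _ hs.2]
    calc _ ≤ (t - s) ^ (θ - 1) * (C * Real.exp (l * s)) :=
          mul_le_mul_of_nonneg_left (hg s ⟨hs.1.le, hs.2⟩)
            (Real.rpow_nonneg (sub_nonneg.2 hs.2) _)
      _ = _ := by ring
  rw [intervalIntegral.integral_const_mul] at h1
  have h2 := mul_le_mul_of_nonneg_left (integral_sub_rpow_mul_exp_le hθ hl ht) hC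
  rw [rlIntegral, norm_mul, Complex.norm_real, Real.norm_of_nonneg (by positivity)]
  calc _ ≤ 1 / Real.Gamma θ * (C * (Real.Gamma θ * (1 / l) ^ θ * Real.exp (l * t))) :=
        mul_le_mul_of_nonneg_left (h1.trans h2) (by positivity)
    _ = _ := by field_simp

theorem intervalIntegrable_rlIntegrand_of_continuousOn {α t : ℝ} (hα : 0 < α) (ht : 0 ≤ t)
    {g : ℝ → ℂ} (hg : ContinuousOn g (Icc 0 t)) :
    IntervalIntegrable (rlIntegrand α g t) MeasureTheory.volume 0 t := by
  have h := intervalIntegrable_sub_rpow hα ht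
  have h' : IntervalIntegrable (fun s => (((t - s) ^ (α - 1) : ℝ) : ℂ)) MeasureTheory.volume 0 t :=
    ⟨MeasureTheory.Integrable.ofReal h.1, MeasureTheory.Integrable.ofReal h.2⟩
  exact h'.mul_continuousOn (by rwa [uIcc_of_le ht])

theorem rlIntegral_sub {α t : ℝ} (hα : 0 < α) (ht : 0 ≤ t) {g h : ℝ → ℂ}
    (hg : ContinuousOn g (Icc 0 t)) (hh : ContinuousOn h (Icc 0 t)) :
    rlIntegral α g t - rlIntegral α h t = rlIntegral α (fun s => g s - h s) t := by
  unfold rlIntegral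
  rw [← mul_sub, ← intervalIntegral.integral_sub
    (intervalIntegrable_rlIntegrand_of_continuousOn hα ht hg)
    (intervalIntegrable_rlIntegrand_of_continuousOn hα ht hh)]
  congr 1
  refine intervalIntegral.integral_congr fun s _ => ?_
  simp only [rlIntegrand]; ring

/-- A continuous solution of a homogeneous linear system of fractional Volterra equations
vanishes. -/
theorem eq_zero_of_eq_rlIntegral {n : ℕ} {θ : Fin n → ℝ} (hθ : ∀ j, 0 < θ j) {S : ℝ}
    {P : Fin n → Fin n → ℝ → ℂ} (hP : ∀ j r, ContinuousOn (P j r) (Icc 0 S))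
    {w : Fin n → ℝ → ℂ} (hw : ∀ j, ContinuousOn (w j) (Icc 0 S))
    (heq : ∀ j, ∀ t ∈ Icc 0 S, w j t = rlIntegral (θ j) (fun s => ∑ r, P j r s * w r s) t) :
    ∀ j, ∀ t ∈ Icc 0 S, w j t = 0 := by
  have hbd : ∀ f : ℝ → ℂ, ContinuousOn f (Icc 0 S) → ∃ B, 0 ≤ B ∧ ∀ t ∈ Icc 0 S, ‖f t‖ ≤ B := by
    intro f hf
    obtain ⟨B, hB⟩ := isCompact_Icc.exists_bound_of_continuousOn hf
    exact ⟨|B|, abs_nonneg _, fun t ht => (hB t ht).trans (le_abs_self B)⟩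
  choose BP hBP0 hBP using fun j r => hbd _ (hP j r)
  choose Bw hBw0 hBw using fun j => hbd _ (hw j)
  set M := ∑ j, ∑ r, BP j r with hM
  have hM0 : 0 ≤ M := Finset.sum_nonneg fun j _ => Finset.sum_nonneg fun r _ => hBP0 j r
  set K := ∑ j, Bw j with hK
  have hK0 : 0 ≤ K := Finset.sum_nonneg fun j _ => hBw0 j
  -- Since `l^(-θ_j) → 0` for each of the finitely many `j`, one large `l` serves all of them.
  obtain ⟨l, hl, hlM⟩ : ∃ l : ℝ, 0 < l ∧ ∀ j, M * (1 / l) ^ θ j ≤ 1 / 2 := by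
    have h1 : ∀ᶠ l : ℝ in Filter.atTop, ∀ j, M * (1 / l) ^ θ j ≤ 1 / 2 := by
      rw [Filter.eventually_all]
      intro j
      have h2 : Filter.Tendsto (fun l : ℝ => M * l ^ (-θ j)) Filter.atTop (nhds (M * 0)) :=
        (tendsto_rpow_neg_atTop (hθ j)).const_mul M
      rw [mul_zero] at h2
      filter_upwards [h2.eventually_lt_const (show (0 : ℝ) < 1 / 2 by norm_num),
        Filter.eventually_gt_atTop 0] with l hl hl0
      rw [one_div, Real.inv_rpow hl0.le, ← Real.rpow_neg hl0.le]
      exact hl.le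
    obtain ⟨l, hl⟩ := (h1.and (Filter.eventually_gt_atTop 0)).exists
    exact ⟨l, hl.2, hl.1⟩
  -- Each substitution into the equation halves the weighted bound.
  have hstep : ∀ i : ℕ, ∀ j, ∀ t ∈ Icc 0 S, ‖w j t‖ ≤ K * (1 / 2) ^ i * Real.exp (l * t) := by
    intro i
    induction i with
    | zero =>
      intro j t ht
      rw [pow_zero, mul_one]
      have h1 : Bw j ≤ K := Finset.single_le_sum (fun j _ => hBw0 j) (Finset.mem_univ j)
      have h2 : 1 ≤ Real.exp (l * t) := Real.one_le_exp (mul_nonneg hl.le ht.1)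
      calc ‖w j t‖ ≤ K * 1 := by rw [mul_one]; exact (hBw j t ht).trans h1
        _ ≤ _ := mul_le_mul_of_nonneg_left h2 hK0
    | succ i ih =>
      intro j t ht
      have hsum : ∀ s ∈ Icc 0 t,
          ‖∑ r, P j r s * w r s‖ ≤ (M * (K * (1 / 2) ^ i)) * Real.exp (l * s) := by
        intro s hs
        have hsS : s ∈ Icc 0 S := ⟨hs.1, hs.2.trans ht.2⟩
        calc _ ≤ ∑ r, BP j r * (K * (1 / 2) ^ i * Real.exp (l * s)) := by
              refine norm_sum_le_of_le _ fun r _ => ?_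
              rw [norm_mul]
              exact mul_le_mul (hBP j r s hsS) (ih r s hsS) (norm_nonneg _) (hBP0 j r)
          _ = (∑ r, BP j r) * (K * (1 / 2) ^ i * Real.exp (l * s)) := by rw [← Finset.sum_mul]
          _ ≤ M * (K * (1 / 2) ^ i * Real.exp (l * s)) := by
              refine mul_le_mul_of_nonneg_right ?_ (by positivity)
              exact Finset.single_le_sum (f := fun j => ∑ r, BP j r)
                (fun j _ => Finset.sum_nonneg fun r _ => hBP0 j r) (Finset.mem_univ j)
          _ = _ := by ring
      rw [heq j t ht]
      refine (norm_rlIntegral_le_exp (hθ j) hl ht.1 (by positivity) hsum).trans ?_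
      calc _ = (M * (1 / l) ^ θ j) * (K * (1 / 2) ^ i * Real.exp (l * t)) := by ring
        _ ≤ 1 / 2 * (K * (1 / 2) ^ i * Real.exp (l * t)) :=
            mul_le_mul_of_nonneg_right (hlM j) (by positivity)
        _ = _ := by ring
  intro j t ht
  have h1 : Filter.Tendsto (fun i : ℕ => K * (1 / 2) ^ i * Real.exp (l * t)) Filter.atTop
      (nhds (K * 0 * Real.exp (l * t))) :=
    ((tendsto_pow_atTop_nhds_zero_of_lt_one (by norm_num) (by norm_num)).const_mul K).mul_const _
  rw [mul_zero, zero_mul] at h1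
  exact norm_le_zero_iff.1 (ge_of_tendsto' h1 fun i => hstep i j t ht)

/-- A denominator of at least `2` excludes integers. The strict inequality makes the order `⌈θ⌉ - θ`
of the integral in the Caputo derivative positive. -/
theorem rat_lt_natCeil {θ : ℚ} (hden : 2 ≤ θ.den) : (θ : ℝ) < ⌈(θ : ℝ)⌉₊ := by
  refine lt_of_le_of_ne (Nat.le_ceil _) fun h => ?_
  have h1 : θ = ((⌈(θ : ℝ)⌉₊ : ℕ) : ℚ) := by exact_mod_cast h
  rw [h1, Rat.den_natCast] at hden
  omega

theorem IsACDiffOn.continuousOn {m : ℕ} {S : ℝ} {v : ℝ → ℂ} (hv : IsACDiffOn m S v) :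
    ContinuousOn v (Icc 0 S) := hv.1.continuousOn

/-- In this form no derivatives appear, and continuity of the solution is all that uniqueness needs.
-/
theorem IsCaputoSolution.volterra {n : ℕ} {θ : Fin n → ℚ} (hθ : ∀ j, 0 < θ j)
    (hden : ∀ j, 2 ≤ (θ j).den) {p : Fin n → Fin (n + 1) → ℝ → ℂ} {v0 : Fin n → ℕ → ℂ} {S : ℝ}
    (hS : 0 < S) {v : Fin n → ℝ → ℂ} (hv : IsCaputoSolution θ p v0 S v) (j : Fin n) :
    ∀ t ∈ Icc 0 S, v j t = initialPoly θ v0 j t + rlIntegral (θ j)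
      (fun t => ∑ r : Fin n, p j r.castSucc t * v r t + p j (Fin.last n) t) t := by
  intro t ht
  rw [eq_add_rlIntegral_of_hasCaputoDerivAt hS (by exact_mod_cast hθ j)
    (rat_lt_natCeil (hden j)) (hv.regular j) (hv.equation j) t ht, initialPoly]
  congr 1
  refine Finset.sum_congr rfl fun k hk => ?_
  rw [hv.initial j k (Finset.mem_range.1 hk)]

/-- Solutions of the initial value problem agree on the smaller of their intervals. -/
theorem IsCaputoSolution.eqOn {n : ℕ} {θ : Fin n → ℚ} (hθ : ∀ j, 0 < θ j)
    (hden : ∀ j, 2 ≤ (θ j).den) {p : Fin n → Fin (n + 1) → ℝ → ℂ} {v0 : Fin n → ℕ → ℂ}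
    {S S' : ℝ} (hS : 0 < S) (hS' : 0 < S') {u v : Fin n → ℝ → ℂ}
    (hp : ∀ j r, ContinuousOn (p j r) (Icc 0 (min S S')))
    (hu : IsCaputoSolution θ p v0 S u) (hv : IsCaputoSolution θ p v0 S' v) (j : Fin n) :
    EqOn (u j) (v j) (Icc 0 (min S S')) := by
  have hs : Icc 0 (min S S') ⊆ Icc 0 S := Icc_subset_Icc_right (min_le_left _ _)
  have hs' : Icc 0 (min S S') ⊆ Icc 0 S' := Icc_subset_Icc_right (min_le_right _ _)
  have hcu : ∀ j, ContinuousOn (u j) (Icc 0 (min S S')) := fun j =>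
    (hu.regular j).continuousOn.mono hs
  have hcv : ∀ j, ContinuousOn (v j) (Icc 0 (min S S')) := fun j =>
    (hv.regular j).continuousOn.mono hs'
  have hrhs : ∀ w : Fin n → ℝ → ℂ, (∀ j, ContinuousOn (w j) (Icc 0 (min S S'))) → ∀ j,
      ContinuousOn (fun t => ∑ r : Fin n, p j r.castSucc t * w r t + p j (Fin.last n) t)
        (Icc 0 (min S S')) := fun w hw j =>
    (continuousOn_finsetSum _ fun r _ => (hp j r.castSucc).mul (hw r)).add (hp j _)
  have h := eq_zero_of_eq_rlIntegral (θ := fun j => (θ j : ℝ)) (fun j => by exact_mod_cast hθ j)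
    (P := fun j r => p j r.castSucc) (fun j r => hp j _)
    (w := fun j t => u j t - v j t) (fun j => (hcu j).sub (hcv j)) (fun j t ht => by
      have hsub : Icc 0 t ⊆ Icc 0 (min S S') := Icc_subset_Icc_right ht.2
      rw [hu.volterra hθ hden hS j t (hs ht), hv.volterra hθ hden hS' j t (hs' ht),
        add_sub_add_left_eq_sub, rlIntegral_sub (by exact_mod_cast hθ j) ht.1
          ((hrhs u hcu j).mono hsub) ((hrhs v hcv j).mono hsub)]
      congr 1
      funext s
      rw [add_sub_add_right_eq_sub, ← Finset.sum_sub_distrib]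
      exact Finset.sum_congr rfl fun r _ => by ring) j
  exact fun t ht => sub_eq_zero.1 (h t ht)

/-! ### Solving a scalar Caputo equation by a generalized power series -/

/-- The chain of successive primitives of `w` with initial values `y 0, …, y (m - 1)`;
the entry `m - i` of the chain is `iteratedPrimitive m y w i`. -/
noncomputable def iteratedPrimitive (m : ℕ) (y : ℕ → ℂ) (w : ℝ → ℂ) : ℕ → ℝ → ℂ
  | 0 => w
  | i + 1 => fun t => y (m - (i + 1)) + ∫ s in (0 : ℝ)..t, iteratedPrimitive m y w i s

theorem iteratedPrimitive_eq {m : ℕ} (y : ℕ → ℂ) (w : ℝ → ℂ) {k : ℕ} (hk : k < m) (t : ℝ) :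
    iteratedPrimitive m y w (m - k) t =
      y k + ∫ s in (0 : ℝ)..t, iteratedPrimitive m y w (m - (k + 1)) s := by
  have h : m - k = (m - (k + 1)) + 1 := by omega
  rw [h, iteratedPrimitive]
  simp only
  rw [show m - (m - (k + 1) + 1) = k by omega]

/-- Multiplication by `(t - s)^(1 - α)`, continuous as `α ≤ 1`, cancels the kernel off `s = t`. -/
theorem IntervalIntegrable.of_rlIntegrand {α t : ℝ} (hα : α ≤ 1) (ht : 0 ≤ t) {g : ℝ → ℂ}
    (hg : IntervalIntegrable (rlIntegrand α g t) MeasureTheory.volume 0 t) :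
    IntervalIntegrable g MeasureTheory.volume 0 t := by
  have h1 : ContinuousOn (fun s => (((t - s) ^ (1 - α) : ℝ) : ℂ)) (uIcc 0 t) :=
    (Complex.continuous_ofReal.comp ((continuous_const.sub continuous_id).rpow_const
      fun _ => Or.inr (by linarith))).continuousOn
  refine (hg.continuousOn_mul h1).congr_ae ?_
  rw [uIoc_of_le ht, Filter.EventuallyEq, MeasureTheory.ae_restrict_iff' measurableSet_Ioc]
  filter_upwards [ae_ne_real t] with s hst hs
  have hlt : 0 < t - s := sub_pos.2 (lt_of_le_of_ne hs.2 hst)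
  rw [rlIntegrand, ← mul_assoc, ← Complex.ofReal_mul, ← Real.rpow_add hlt]
  simp

/-- Take for `w` the formal derivative of order `⌈θ⌉` of `∑ c_k t^(θ + k/q)`. Termwise, `I^⌈θ⌉ w`
returns this series and, by `hcd`, `I^(⌈θ⌉-θ) w` is `∑ d_k t^(k/q)`; the function sought is the
repeated primitive of `w` with initial values `y`. -/
theorem exists_hasCaputoDerivAt_series {θ S : ℝ} (hθ : 0 < θ) (hlt : θ < ⌈θ⌉₊) (hS : 0 < S)
    {q : ℕ} {c d : ℕ → ℂ}
    (hcd : ∀ k : ℕ, c k = ((Real.Gamma ((k : ℝ) / q + 1) / Real.Gamma (θ + (k : ℝ) / q + 1) : ℝ) : ℂ)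
      * d k)
    (hc : Summable fun k : ℕ => ‖c k‖ * S ^ (θ + (k : ℝ) / q))
    (hd : Summable fun k : ℕ => ‖d k‖ * S ^ ((k : ℝ) / q)) (y : ℕ → ℂ) :
    ∃ u : ℝ → ℂ, IsACDiffOn ⌈θ⌉₊ S u ∧
      (∀ k < ⌈θ⌉₊, iteratedDerivWithin k u (Icc 0 S) 0 = y k) ∧
      (∀ t ∈ Icc 0 S, HasSum (fun k : ℕ => c k * ((t ^ (θ + (k : ℝ) / q) : ℝ) : ℂ))
        (u t - ∑ l ∈ Finset.range ⌈θ⌉₊, y l / (l.factorial : ℂ) * (t : ℂ) ^ l)) ∧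
      ∀ t ∈ Ioc 0 S, ∀ g : ℂ, HasSum (fun k : ℕ => d k * ((t ^ ((k : ℝ) / q) : ℝ) : ℂ)) g →
        HasCaputoDerivAt S θ u g t := by
  obtain ⟨m, hm⟩ : ∃ m, ⌈θ⌉₊ = m + 1 := Nat.exists_eq_succ_of_ne_zero (Nat.ceil_pos.2 hθ).ne'
  have hmθ : (m : ℝ) < θ := by
    have : m < ⌈θ⌉₊ := by omega
    exact Nat.lt_ceil.1 this
  unfold HasCaputoDerivAt
  rw [hm] at hlt ⊢
  set M : ℝ := ((m + 1 : ℕ) : ℝ) with hM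
  have hMm : M = m + 1 := by rw [hM]; push_cast; ring
  -- The exponents of `w` are `β k - 1 = θ + k/q - ⌈θ⌉`; as `m = ⌈θ⌉ - 1 < θ`, they exceed `-1`.
  let β : ℕ → ℝ := fun k => θ - m + (k : ℝ) / q
  have hkq : ∀ k : ℕ, 0 ≤ (k : ℝ) / q := fun k => by positivity
  have hβ : ∀ k, 0 < β k := fun k => by
    have := hkq k
    simp only [β]; linarith
  have hx : ∀ k, M + β k = θ + (k : ℝ) / q + 1 := fun k => by simp only [β, hMm]; ring
  have hx' : ∀ k, M - θ + β k = (k : ℝ) / q + 1 := fun k => by simp only [β, hMm]; ring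
  have hGβ : ∀ k, 0 < Real.Gamma (β k) := fun k => Real.Gamma_pos_of_pos (hβ k)
  have hGx : ∀ k : ℕ, 0 < Real.Gamma (θ + (k : ℝ) / q + 1) := fun k =>
    Real.Gamma_pos_of_pos (by have := hkq k; linarith)
  have hGx' : ∀ k : ℕ, 0 < Real.Gamma ((k : ℝ) / q + 1) := fun k =>
    Real.Gamma_pos_of_pos (by have := hkq k; linarith)
  -- The factor produced by formally differentiating `t^(θ + k/q)` `M` times.
  let ρ : ℕ → ℝ := fun k => Real.Gamma (θ + (k : ℝ) / q + 1) / Real.Gamma (β k)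
  have hρ : ∀ k, 0 < ρ k := fun k => div_pos (hGx k) (hGβ k)
  let e : ℕ → ℂ := fun k => c k * (ρ k : ℂ)
  let w : ℝ → ℂ := fun s => ∑' k, e k * ((s ^ (β k - 1) : ℝ) : ℂ)
  have hMpos : 0 < M := by rw [hMm]; positivity
  have hen : ∀ k, ‖e k‖ = ‖c k‖ * ρ k := fun k => by
    simp only [e]; rw [norm_mul, Complex.norm_real, Real.norm_of_nonneg (hρ k).le]
  have hcdn : ∀ k, ‖c k‖ = Real.Gamma ((k : ℝ) / q + 1) / Real.Gamma (θ + (k : ℝ) / q + 1) * ‖d k‖ :=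
    fun k => by
      rw [hcd k, norm_mul, Complex.norm_real,
        Real.norm_of_nonneg (div_pos (hGx' k) (hGx k)).le]
  -- the two fractional integrals of `w`
  have hI : ∀ t ∈ Ioc 0 S, HasSum (fun k : ℕ => c k * ((t ^ (θ + (k : ℝ) / q) : ℝ) : ℂ))
      (rlIntegral M w t) := by
    intro t ht
    have hs : Summable fun k => ‖e k‖ *
        (Real.Gamma (β k) / Real.Gamma (M + β k) * t ^ (M + β k - 1)) := by
      refine Summable.of_nonneg_of_le (fun k => ?_) (fun k => ?_) hc
      · rw [hx]
        have := ht.1; have := hGβ k; have := hGx k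
        positivity
      · rw [hen, hx, add_sub_cancel_right]
        have h1 : ‖c k‖ * ρ k * (Real.Gamma (β k) / Real.Gamma (θ + (k : ℝ) / q + 1) *
            t ^ (θ + (k : ℝ) / q)) = ‖c k‖ * t ^ (θ + (k : ℝ) / q) := by
          have := (hGβ k).ne'; have := (hGx k).ne'
          simp only [ρ]; field_simp
        rw [h1]
        exact mul_le_mul_of_nonneg_left (Real.rpow_le_rpow ht.1.le ht.2
          (by have := hkq k; linarith)) (norm_nonneg _)
    refine (rlIntegral_tsum hMpos ht.1 hβ hs).2.congr_fun fun k => ?_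
    rw [hx, add_sub_cancel_right]
    simp only [e, ρ]
    rw [mul_assoc, ← Complex.ofReal_mul]
    congr 2
    have := (hGβ k).ne'; have := (hGx k).ne'
    field_simp
  have hI' : ∀ t ∈ Ioc 0 S,
      IntervalIntegrable (rlIntegrand (M - θ) w t) MeasureTheory.volume 0 t ∧
      HasSum (fun k : ℕ => d k * ((t ^ ((k : ℝ) / q) : ℝ) : ℂ)) (rlIntegral (M - θ) w t) := by
    intro t ht
    have hs : Summable fun k => ‖e k‖ *
        (Real.Gamma (β k) / Real.Gamma (M - θ + β k) * t ^ (M - θ + β k - 1)) := by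
      refine Summable.of_nonneg_of_le (fun k => ?_) (fun k => ?_) hd
      · rw [hx']
        have := ht.1; have := hGβ k; have := hGx' k
        positivity
      · rw [hen, hcdn, hx', add_sub_cancel_right]
        have h1 : Real.Gamma ((k : ℝ) / q + 1) / Real.Gamma (θ + (k : ℝ) / q + 1) * ‖d k‖ * ρ k *
            (Real.Gamma (β k) / Real.Gamma ((k : ℝ) / q + 1) * t ^ ((k : ℝ) / q)) =
              ‖d k‖ * t ^ ((k : ℝ) / q) := by
          have := (hGβ k).ne'; have := (hGx k).ne'; have := (hGx' k).ne'
          simp only [ρ]; field_simp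
        rw [h1]
        exact mul_le_mul_of_nonneg_left (Real.rpow_le_rpow ht.1.le ht.2 (hkq k)) (norm_nonneg _)
    refine ⟨(rlIntegral_tsum (sub_pos.2 hlt) ht.1 hβ hs).1, ?_⟩
    refine (rlIntegral_tsum (sub_pos.2 hlt) ht.1 hβ hs).2.congr_fun fun k => ?_
    rw [hx', add_sub_cancel_right]
    simp only [e, ρ]
    rw [hcd k, mul_comm _ (d k), mul_assoc, mul_assoc, ← Complex.ofReal_mul, ← Complex.ofReal_mul]
    congr 2
    have := (hGβ k).ne'; have := (hGx k).ne'; have := (hGx' k).ne'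
    field_simp
  -- Since `M - θ ≤ 1`, convergence of the fractional integral at the endpoint `S` already makes `w`
  -- integrable.
  have hw : IntervalIntegrable w MeasureTheory.volume 0 S :=
    (hI' S ⟨hS, le_rfl⟩).1.of_rlIntegrand (by linarith) hS.le
  -- the chain of primitives of `w`
  let F : ℕ → ℝ → ℂ := fun k => iteratedPrimitive (m + 1) y w (m + 1 - k)
  have hFm : F (m + 1) = w := by simp only [F, Nat.sub_self, iteratedPrimitive]
  have hF0 : ∀ k < m + 1, F k 0 = y k := fun k hk => by
    simp only [F]; rw [iteratedPrimitive_eq y w hk]; simp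
  have hF : ∀ k < m + 1, ∀ t ∈ Icc 0 S, F k t = F k 0 + ∫ s in (0 : ℝ)..t, F (k + 1) s :=
    fun k hk t _ => by rw [hF0 k hk]; exact iteratedPrimitive_eq y w hk t
  have hwF : IntervalIntegrable (F (m + 1)) MeasureTheory.volume 0 S := by rwa [hFm]
  obtain ⟨hAC, hae⟩ := isACDiffOn_chain hS hwF hF
  have hT := taylor_rlIntegral hS.le F hwF hF
  rw [hFm] at hae hT
  refine ⟨F 0, hAC, fun k hk => ?_, fun t ht => ?_, fun t ht g hg => ?_⟩
  · rw [iteratedDerivWithin_chain hS hwF hF k hk (left_mem_Icc.2 hS.le), hF0 k hk]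
  · have h1 : F 0 t - ∑ l ∈ Finset.range (m + 1), y l / (l.factorial : ℂ) * (t : ℂ) ^ l =
        rlIntegral M w t := by
      rw [hT t ht, sub_eq_iff_eq_add, add_comm]
      congr 1
      exact Finset.sum_congr rfl fun l hl => by rw [hF0 l (Finset.mem_range.1 hl)]
    rw [h1]
    rcases ht.1.eq_or_lt with rfl | ht0
    · have h2 : rlIntegral M w 0 = 0 := by simp [rlIntegral]
      rw [h2]
      refine hasSum_zero.congr_fun fun k => ?_
      rw [Real.zero_rpow (by have := hkq k; linarith)]; simp
    · exact hI t ⟨ht0, ht.2⟩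
  · have hsub : ∀ᵐ x, x ∈ Ioc 0 t → w x = iteratedDerivWithin (m + 1) (F 0) (Icc 0 S) x := by
      filter_upwards [hae] with x hx hxt
      exact (hx ⟨hxt.1, hxt.2.trans ht.2⟩).symm
    refine ⟨intervalIntegrable_rlIntegrand_congr ht.1.le hsub (hI' t ht).1, ?_⟩
    rw [← rlIntegral_congr ht.1.le hsub]
    exact (hI' t ht).2.unique hg

/-! ### Absolutely convergent power series in a real variable -/

/-- `∑ c_k z^k` converges absolutely, with sum `x`. -/
def HasAbsPowerSum (c : ℕ → ℂ) (z : ℝ) (x : ℂ) : Prop :=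
  Summable (fun k => ‖c k * (z : ℂ) ^ k‖) ∧ HasSum (fun k => c k * (z : ℂ) ^ k) x

theorem HasAbsPowerSum.add {c d : ℕ → ℂ} {z : ℝ} {x y : ℂ} (hc : HasAbsPowerSum c z x)
    (hd : HasAbsPowerSum d z y) : HasAbsPowerSum (fun k => c k + d k) z (x + y) := by
  simp only [HasAbsPowerSum, add_mul]
  exact ⟨Summable.of_nonneg_of_le (fun _ => norm_nonneg _) (fun _ => norm_add_le _ _)
    (hc.1.add hd.1), hc.2.add hd.2⟩

theorem HasAbsPowerSum.sum {ι : Type*} {s : Finset ι} {c : ι → ℕ → ℂ} {z : ℝ} {x : ι → ℂ}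
    (hc : ∀ i ∈ s, HasAbsPowerSum (c i) z (x i)) :
    HasAbsPowerSum (fun k => ∑ i ∈ s, c i k) z (∑ i ∈ s, x i) := by
  simp only [HasAbsPowerSum, Finset.sum_mul]
  exact ⟨Summable.of_nonneg_of_le (fun _ => norm_nonneg _) (fun _ => norm_sum_le _ _)
    (summable_sum fun i hi => (hc i hi).1), hasSum_sum fun i hi => (hc i hi).2⟩

theorem HasAbsPowerSum.mul {c d : ℕ → ℂ} {z : ℝ} {x y : ℂ} (hc : HasAbsPowerSum c z x)
    (hd : HasAbsPowerSum d z y) :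
    HasAbsPowerSum (fun k => ∑ l ∈ Finset.range (k + 1), c l * d (k - l)) z (x * y) := by
  have e : ∀ k, (∑ l ∈ Finset.range (k + 1), c l * d (k - l)) * (z : ℂ) ^ k =
      ∑ l ∈ Finset.range (k + 1), c l * (z : ℂ) ^ l * (d (k - l) * (z : ℂ) ^ (k - l)) := by
    intro k
    rw [Finset.sum_mul]
    refine Finset.sum_congr rfl fun l hl => ?_
    have : k = l + (k - l) := by have := Finset.mem_range.1 hl; omega
    conv_lhs => rw [this, pow_add, ← this]
    ring
  simp only [HasAbsPowerSum, e]
  refine ⟨summable_norm_sum_mul_range_of_summable_norm (f := fun k => c k * (z : ℂ) ^ k)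
    (g := fun k => d k * (z : ℂ) ^ k) hc.1 hd.1, ?_⟩
  have := hasSum_sum_range_mul_of_summable_norm (f := fun k => c k * (z : ℂ) ^ k)
    (g := fun k => d k * (z : ℂ) ^ k) hc.1 hd.1
  rwa [hc.2.tsum_eq, hd.2.tsum_eq] at this

/-- Each term is at most the sum of all norms: a Cauchy estimate with ratio `1 / z`. -/
theorem HasAbsPowerSum.exists_bound {c : ℕ → ℂ} {z : ℝ} {x : ℂ} (hz : 0 < z)
    (hc : HasAbsPowerSum c z x) : ∃ B, 0 ≤ B ∧ ∀ k, ‖c k‖ ≤ B * (1 / z) ^ k := by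
  refine ⟨∑' k, ‖c k * (z : ℂ) ^ k‖, tsum_nonneg fun _ => norm_nonneg _, fun k => ?_⟩
  have h := hc.1.le_tsum k fun _ _ => norm_nonneg _
  rw [norm_mul, norm_pow, Complex.norm_real, Real.norm_of_nonneg hz.le] at h
  rw [one_div, inv_pow, ← div_eq_mul_inv, le_div_iff₀ (pow_pos hz k)]
  exact h

/-- The Taylor series of an analytic function of a real variable converges absolutely to it on a
closed interval around the centre. -/
theorem AnalyticAt.exists_hasAbsPowerSum {g : ℝ → ℂ} (hg : AnalyticAt ℝ g 0) :
    ∃ r : ℝ, 0 < r ∧ ∀ z ∈ Icc 0 r,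
      HasAbsPowerSum (fun k => iteratedDeriv k g 0 / (k.factorial : ℂ)) z (g z) := by
  obtain ⟨P, R, hR⟩ := hg
  obtain ⟨r, hr0, hrR⟩ := ENNReal.lt_iff_exists_nnreal_btwn.1 hR.r_pos
  have hcoef : ∀ k, P.coeff k = iteratedDeriv k g 0 / (k.factorial : ℂ) := by
    intro k
    have h1 := hR.factorial_smul 1 k
    rw [FormalMultilinearSeries.apply_eq_pow_smul_coeff, one_pow, one_smul,
      ← iteratedDeriv_eq_iteratedFDeriv, nsmul_eq_mul] at h1
    rw [← h1, mul_div_cancel_left₀ _ (by exact_mod_cast k.factorial_ne_zero)]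
  refine ⟨r, by exact_mod_cast hr0, fun z hz => ⟨?_, ?_⟩⟩
  · have h1 := P.summable_norm_mul_pow (hrR.trans_le hR.r_le)
    refine Summable.of_nonneg_of_le (fun _ => norm_nonneg _) (fun k => ?_) h1
    simp only [← hcoef]
    rw [norm_mul, norm_pow, Complex.norm_real, Real.norm_of_nonneg hz.1,
      FormalMultilinearSeries.norm_apply_eq_norm_coef]
    exact mul_le_mul_of_nonneg_left (pow_le_pow_left₀ hz.1 hz.2 k) (norm_nonneg _)
  · have hzb : z ∈ Metric.eball (0 : ℝ) R := by
      rw [Metric.mem_eball, edist_zero_right]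
      refine lt_of_le_of_lt ?_ hrR
      rw [← ofReal_norm, Real.norm_of_nonneg hz.1]
      exact ENNReal.ofReal_le_of_le_toReal hz.2
    have h1 := hR.hasSum hzb
    rw [zero_add] at h1
    refine h1.congr_fun fun k => ?_
    rw [FormalMultilinearSeries.apply_eq_pow_smul_coeff, hcoef, mul_comm]
    simp [Complex.real_smul]

/-! ### The coefficients of the product with `exp (i ω z^q)` -/

/-- The coefficients of the product of `∑ a_m z^m` with `exp (i ω z^q)`. -/
noncomputable def modulatedCoeff (q : ℕ) (ω : ℝ) (a : ℕ → ℂ) (k : ℕ) : ℂ :=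
  ∑ m₁ ∈ Finset.range (k + 1), ∑ m₂ ∈ Finset.range (k + 1),
    if m₁ + q * m₂ = k then a m₁ * ((Complex.I * (ω : ℂ)) ^ m₂ / (m₂.factorial : ℂ)) else 0

/-- Since `m₂ ≤ q m₂`, larger index ranges add only zeros. A range independent of `k` allows sums to
be interchanged. -/
theorem modulatedCoeff_eq_of_le {q : ℕ} (hq : 0 < q) (ω : ℝ) (a : ℕ → ℂ) {k N : ℕ} (hk : k ≤ N) :
    modulatedCoeff q ω a k =
      ∑ m₁ ∈ Finset.range (N + 1), ∑ m₂ ∈ Finset.range (N + 1),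
        if m₁ + q * m₂ = k then a m₁ * ((Complex.I * (ω : ℂ)) ^ m₂ / (m₂.factorial : ℂ))
        else 0 := by
  have hsub : Finset.range (k + 1) ⊆ Finset.range (N + 1) := by
    intro x; simp only [Finset.mem_range]; omega
  have hle : ∀ m₂ : ℕ, m₂ ≤ q * m₂ := fun m₂ => Nat.le_mul_of_pos_left m₂ hq
  rw [modulatedCoeff]
  have h1 : ∀ m₁, ∑ m₂ ∈ Finset.range (k + 1),
      (if m₁ + q * m₂ = k then a m₁ * ((Complex.I * (ω : ℂ)) ^ m₂ / (m₂.factorial : ℂ)) else 0) =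
      ∑ m₂ ∈ Finset.range (N + 1),
      (if m₁ + q * m₂ = k then a m₁ * ((Complex.I * (ω : ℂ)) ^ m₂ / (m₂.factorial : ℂ)) else 0) := by
    intro m₁
    refine Finset.sum_subset hsub fun m₂ _ hm => if_neg fun h => hm ?_
    have := hle m₂
    rw [Finset.mem_range]; omega
  simp_rw [h1]
  refine Finset.sum_subset hsub fun m₁ _ hm => Finset.sum_eq_zero fun m₂ _ => if_neg fun h => hm ?_
  rw [Finset.mem_range]; omega

/-- Grouping the double sum by `k = m₁ + q m₂` turns it into a Cauchy product with the coefficients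
of the modulated function. -/
theorem sum_modulatedCoeff_mul {q : ℕ} (hq : 0 < q) (ω : ℝ) (a c : ℕ → ℂ) (N : ℕ) :
    ∑ m₁ ∈ Finset.range (N + 1), ∑ m₂ ∈ Finset.range (N + 1),
      (if m₁ + q * m₂ ≤ N then
        a m₁ * ((Complex.I * (ω : ℂ)) ^ m₂ / (m₂.factorial : ℂ)) * c (N - (m₁ + q * m₂)) else 0) =
    ∑ k ∈ Finset.range (N + 1), modulatedCoeff q ω a k * c (N - k) := by
  have h1 : ∀ k ∈ Finset.range (N + 1), modulatedCoeff q ω a k * c (N - k) =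
      ∑ m₁ ∈ Finset.range (N + 1), ∑ m₂ ∈ Finset.range (N + 1),
        if m₁ + q * m₂ = k then
          a m₁ * ((Complex.I * (ω : ℂ)) ^ m₂ / (m₂.factorial : ℂ)) * c (N - k) else 0 := by
    intro k hk
    rw [modulatedCoeff_eq_of_le hq ω a (Nat.lt_succ_iff.1 (Finset.mem_range.1 hk)), Finset.sum_mul]
    refine Finset.sum_congr rfl fun m₁ _ => ?_
    rw [Finset.sum_mul]
    refine Finset.sum_congr rfl fun m₂ _ => ?_
    rw [ite_mul, zero_mul]
  rw [Finset.sum_congr rfl h1]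
  refine Eq.trans ?_ Finset.sum_comm
  refine Finset.sum_congr rfl fun m₁ _ => ?_
  refine Eq.trans ?_ Finset.sum_comm
  refine Finset.sum_congr rfl fun m₂ _ => ?_
  rw [Finset.sum_ite_eq]
  simp only [Finset.mem_range, Nat.lt_succ_iff]

/-- The exponential series reindexed along `l ↦ q l`, which carries the whole support. -/
theorem hasAbsPowerSum_exp {q : ℕ} (hq : 0 < q) (ω z : ℝ) :
    HasAbsPowerSum (fun k => if q ∣ k then
        (Complex.I * (ω : ℂ)) ^ (k / q) / ((k / q).factorial : ℂ) else 0) z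
      (Complex.exp (Complex.I * (ω : ℂ) * (z : ℂ) ^ q)) := by
  have hinj : Function.Injective fun l : ℕ => q * l := fun a b h => Nat.eq_of_mul_eq_mul_left hq h
  have hsupp : ∀ k ∉ Set.range (fun l : ℕ => q * l), (if q ∣ k then
      (Complex.I * (ω : ℂ)) ^ (k / q) / ((k / q).factorial : ℂ) else 0) * (z : ℂ) ^ k = 0 := by
    intro k hk
    rw [if_neg, zero_mul]
    rintro ⟨l, rfl⟩
    exact hk ⟨l, rfl⟩
  have hcomp : ∀ l : ℕ, (if q ∣ q * l then
      (Complex.I * (ω : ℂ)) ^ (q * l / q) / ((q * l / q).factorial : ℂ) else 0) * (z : ℂ) ^ (q * l)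
      = (Complex.I * (ω : ℂ) * (z : ℂ) ^ q) ^ l / (l.factorial : ℂ) := by
    intro l
    rw [if_pos (dvd_mul_right q l), Nat.mul_div_cancel_left l hq, pow_mul,
      mul_pow _ ((z : ℂ) ^ q)]
    ring
  constructor
  · rw [← hinj.summable_iff (fun k hk => by rw [hsupp k hk, norm_zero])]
    refine (NormedSpace.norm_expSeries_div_summable
      (Complex.I * (ω : ℂ) * (z : ℂ) ^ q)).congr fun l => ?_
    simp only [Function.comp, hcomp]
  · rw [← hinj.hasSum_iff hsupp, Complex.exp_eq_exp_ℂ]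
    refine (NormedSpace.expSeries_div_hasSum_exp
      (Complex.I * (ω : ℂ) * (z : ℂ) ^ q)).congr_fun fun l => ?_
    simp only [Function.comp, hcomp]

theorem HasAbsPowerSum.modulated {q : ℕ} (hq : 0 < q) (ω : ℝ) {a : ℕ → ℂ} {z : ℝ} {x : ℂ}
    (ha : HasAbsPowerSum a z x) : HasAbsPowerSum (modulatedCoeff q ω a) z
      (x * Complex.exp (Complex.I * (ω : ℂ) * (z : ℂ) ^ q)) := by
  have h := ha.mul (hasAbsPowerSum_exp hq ω z)
  convert h using 1
  funext k
  refine Finset.sum_congr rfl fun m₁ hm₁ => ?_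
  have hm := Nat.lt_succ_iff.1 (Finset.mem_range.1 hm₁)
  by_cases hd : q ∣ k - m₁
  · obtain ⟨l, hl⟩ := hd
    have hlk : l ≤ q * l := Nat.le_mul_of_pos_left l hq
    rw [Finset.sum_eq_single l, if_pos (by omega), if_pos ⟨l, hl⟩, hl, Nat.mul_div_cancel_left l hq]
    · intro b _ hb
      refine if_neg fun h => hb (Nat.eq_of_mul_eq_mul_left hq ?_)
      omega
    · intro hl'
      exact absurd (Finset.mem_range.2 (by omega)) hl'
  · rw [if_neg hd, mul_zero]
    refine Finset.sum_eq_zero fun m₂ _ => if_neg fun h => hd ⟨m₂, by omega⟩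

/-! ### The recurrence -/

theorem commonDen_pos {n : ℕ} (θ : Fin n → ℚ) : 0 < commonDen θ := by
  refine Nat.pos_of_ne_zero fun h => ?_
  obtain ⟨j, -, hj⟩ := Finset.lcm_eq_zero_iff.1 h
  exact (θ j).den_nz hj

theorem startIndex_pos {n : ℕ} {θ : Fin n → ℚ} (hθ : ∀ j, 0 < θ j) (j : Fin n) :
    0 < startIndex θ j := by
  have h := startIndex_cast θ hθ j
  have hq : (0 : ℚ) < commonDen θ := by exact_mod_cast commonDen_pos θ
  have : (0 : ℚ) < startIndex θ j := by rw [h]; exact mul_pos (hθ j) hq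
  exact_mod_cast this

theorem startIndex_div {n : ℕ} {θ : Fin n → ℚ} (hθ : ∀ j, 0 < θ j) (j : Fin n) :
    (startIndex θ j : ℝ) / commonDen θ = θ j := by
  have hq : (commonDen θ : ℝ) ≠ 0 := by exact_mod_cast (commonDen_pos θ).ne'
  rw [div_eq_iff hq]
  exact_mod_cast startIndex_cast θ hθ j

/-- The right-hand side of the recurrence, in terms of the coefficients `b` of the functions
`p_{j,r}` themselves. -/
noncomputable def recurrenceRhs {n : ℕ} (b : Fin (n + 1) → ℕ → ℂ) (c : Fin n → ℕ → ℂ) (N : ℕ) : ℂ :=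
  (∑ r : Fin n, ∑ k ∈ Finset.range (N + 1), b r.castSucc k * c r (N - k)) + b (Fin.last n) N

/-- This is the fixed-point form used for recursion and estimates. -/
theorem isCoeffFamily_iff {n : ℕ} {θ : Fin n → ℚ} (ω : ℝ) (a : Fin n → Fin (n + 1) → ℕ → ℂ)
    (v0 : Fin n → ℕ → ℂ) (c : Fin n → ℕ → ℂ) :
    IsCoeffFamily θ ω a v0 c ↔ ∀ μ j, c j μ =
      if μ < startIndex θ j then
        if commonDen θ ∣ μ then
          v0 j (μ / commonDen θ) / ((μ / commonDen θ).factorial : ℂ) else 0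
      else ((Real.Gamma ((μ : ℝ) / commonDen θ - θ j + 1) /
          Real.Gamma ((μ : ℝ) / commonDen θ + 1) : ℝ) : ℂ) *
        recurrenceRhs (fun r => modulatedCoeff (commonDen θ) ω (a j r)) c
          (μ - startIndex θ j) := by
  have hq := commonDen_pos θ
  simp only [recurrenceRhs, ← sum_modulatedCoeff_mul hq]
  constructor
  · intro h μ j
    split_ifs with h1 h2
    · rw [h.low j μ h1, if_pos h2]
    · rw [h.low j μ h1, if_neg h2]
    · exact h.high j μ (not_lt.1 h1)
  · intro h
    refine ⟨fun j μ hμ => ?_, fun j μ hμ => ?_⟩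
    · rw [h μ j, if_pos hμ]
    · rw [h μ j, if_neg (not_lt.2 hμ)]; rfl

/-- A recursion in which the value at `μ` depends only on earlier values has a unique solution. -/
theorem existsUnique_of_causal {X : Type*} [Inhabited X] (Φ : (ℕ → X) → ℕ → X)
    (hΦ : ∀ c c' μ, (∀ ν < μ, c ν = c' ν) → Φ c μ = Φ c' μ) : ∃! c : ℕ → X, ∀ μ, c μ = Φ c μ := by
  -- Entries not yet constructed are filled with `default`; causality makes their value irrelevant.
  let c : ℕ → X := Nat.lt_wfRel.wf.fix fun μ ih =>
    Φ (fun ν => if h : ν < μ then ih ν h else default) μ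
  refine ⟨c, fun μ => ?_, fun c' hc' => ?_⟩
  · have h1 : c μ = Φ (fun ν => if _ : ν < μ then c ν else default) μ :=
      WellFounded.fix_eq _ _ μ
    conv_lhs => rw [h1]
    exact hΦ _ _ μ fun ν hν => by simp [hν]
  · funext μ
    induction μ using Nat.strong_induction_on with
    | _ μ ih =>
      have h1 : c μ = Φ (fun ν => if _ : ν < μ then c ν else default) μ :=
        WellFounded.fix_eq _ _ μ
      rw [h1, hc' μ]
      exact hΦ _ _ μ fun ν hν => by simp [hν, ih ν hν]

/-- The recursion runs over `μ` for all `j` at once, since the equations couple the components;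
`startIndex_pos` makes it causal. -/
theorem existsUnique_isCoeffFamily {n : ℕ} {θ : Fin n → ℚ} (hθ : ∀ j, 0 < θ j) (ω : ℝ)
    (a : Fin n → Fin (n + 1) → ℕ → ℂ) (v0 : Fin n → ℕ → ℂ) :
    ∃! c : Fin n → ℕ → ℂ, IsCoeffFamily θ ω a v0 c := by
  obtain ⟨c, hc, hu⟩ := existsUnique_of_causal
    (fun (c : ℕ → Fin n → ℂ) (μ : ℕ) (j : Fin n) =>
      if μ < startIndex θ j then
        if commonDen θ ∣ μ then
          v0 j (μ / commonDen θ) / ((μ / commonDen θ).factorial : ℂ) else 0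
      else ((Real.Gamma ((μ : ℝ) / commonDen θ - θ j + 1) /
          Real.Gamma ((μ : ℝ) / commonDen θ + 1) : ℝ) : ℂ) *
        recurrenceRhs (fun r => modulatedCoeff (commonDen θ) ω (a j r)) (fun j μ => c μ j)
          (μ - startIndex θ j)) (by
      intro c c' μ h
      funext j
      split_ifs with h1 h2
      · rfl
      · rfl
      · congr 1
        simp only [recurrenceRhs]
        congr 1
        refine Finset.sum_congr rfl fun r _ => Finset.sum_congr rfl fun k _ => ?_
        rw [h _ (by have := startIndex_pos hθ j; omega)])
  refine ⟨fun j μ => c μ j, ?_, fun c' hc' => ?_⟩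
  · simp only [isCoeffFamily_iff]
    exact fun μ j => congrFun (hc μ) j
  · have hc'' := (isCoeffFamily_iff ω a v0 c').1 hc'
    have := hu (fun μ j => c' j μ) fun μ => funext fun j => hc'' μ j
    funext j μ
    exact congrFun (congrFun this μ) j

/-- As `ρ ≤ R / 2`, each of the `n` convolutions is dominated by a geometric sum of ratio `1/2`,
hence costs a factor `2`; the inhomogeneity contributes the extra `1`. -/
theorem norm_recurrenceRhs_le {n : ℕ} {b : Fin (n + 1) → ℕ → ℂ} {c : Fin n → ℕ → ℂ} {N : ℕ}
    {B ρ C R : ℝ} (hB : 0 ≤ B) (hρ : 0 ≤ ρ) (hC : 1 ≤ C) (hR : 2 * ρ ≤ R)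
    (hb : ∀ r k, ‖b r k‖ ≤ B * ρ ^ k) (hc : ∀ r, ∀ k ≤ N, ‖c r k‖ ≤ C * R ^ k) :
    ‖recurrenceRhs b c N‖ ≤ B * (2 * n + 1) * C * R ^ N := by
  have hR0 : 0 ≤ R := by linarith
  have hterm : ∀ r : Fin n, ∀ k ∈ Finset.range (N + 1),
      ‖b r.castSucc k * c r (N - k)‖ ≤ B * C * R ^ N * (1 / 2) ^ k := by
    intro r k hk
    have hk' : k ≤ N := Nat.lt_succ_iff.1 (Finset.mem_range.1 hk)
    rw [norm_mul]
    calc _ ≤ B * ρ ^ k * (C * R ^ (N - k)) :=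
          mul_le_mul (hb _ k) (hc r _ (Nat.sub_le _ _)) (norm_nonneg _) (by positivity)
      _ ≤ B * (R / 2) ^ k * (C * R ^ (N - k)) := by
          have : ρ ^ k ≤ (R / 2) ^ k := pow_le_pow_left₀ hρ (by linarith) k
          gcongr
      _ = B * C * (R ^ k * R ^ (N - k)) * (1 / 2) ^ k := by rw [div_pow, div_pow, one_pow]; ring
      _ = _ := by rw [← pow_add, Nat.add_sub_cancel' hk']
  have hsum : ∀ r : Fin n, ‖∑ k ∈ Finset.range (N + 1), b r.castSucc k * c r (N - k)‖ ≤
      B * C * R ^ N * 2 := by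
    intro r
    refine (norm_sum_le_of_le _ (hterm r)).trans ?_
    rw [← Finset.mul_sum]
    exact mul_le_mul_of_nonneg_left (sum_geometric_two_le _) (by positivity)
  have hlast : ‖b (Fin.last n) N‖ ≤ B * C * R ^ N := by
    calc _ ≤ B * ρ ^ N := hb _ _
      _ ≤ B * R ^ N := mul_le_mul_of_nonneg_left (pow_le_pow_left₀ hρ (by linarith) N) hB
      _ = B * 1 * R ^ N := by ring
      _ ≤ _ := by gcongr
  calc _ ≤ ‖∑ r : Fin n, ∑ k ∈ Finset.range (N + 1), b r.castSucc k * c r (N - k)‖ +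
        ‖b (Fin.last n) N‖ := norm_add_le _ _
    _ ≤ (∑ _r : Fin n, B * C * R ^ N * 2) + B * C * R ^ N :=
        add_le_add (norm_sum_le_of_le _ fun r _ => hsum r) hlast
    _ = _ := by
        rw [Finset.sum_const, Finset.card_univ, Fintype.card_fin, nsmul_eq_mul]; ring

/-- Geometric growth of the coefficients. -/
theorem IsCoeffFamily.exists_norm_le {n : ℕ} {θ : Fin n → ℚ} (hθ : ∀ j, 0 < θ j) {ω : ℝ}
    {a : Fin n → Fin (n + 1) → ℕ → ℂ} {v0 : Fin n → ℕ → ℂ} {c : Fin n → ℕ → ℂ}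
    (hc : IsCoeffFamily θ ω a v0 c) {B ρ : ℝ} (hB : 0 ≤ B) (hρ : 0 ≤ ρ)
    (hb : ∀ j r k, ‖modulatedCoeff (commonDen θ) ω (a j r) k‖ ≤ B * ρ ^ k) :
    ∃ C R : ℝ, 1 ≤ C ∧ 1 ≤ R ∧ ∀ j μ, ‖c j μ‖ ≤ C * R ^ μ := by
  rw [isCoeffFamily_iff] at hc
  set Γ₀ : ℝ := ∑ j, 1 / Real.Gamma (1 + θ j) with hΓ₀
  have hθ' : ∀ j, (0 : ℝ) < θ j := fun j => by exact_mod_cast hθ j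
  have hΓpos : ∀ j, 0 ≤ 1 / Real.Gamma (1 + (θ j : ℝ)) := fun j =>
    one_div_nonneg.2 (Real.Gamma_pos_of_pos (by linarith [hθ' j])).le
  have hΓ₀0 : 0 ≤ Γ₀ := Finset.sum_nonneg fun j _ => hΓpos j
  set C₀ : ℝ := ∑ j, ∑ μ ∈ Finset.range (startIndex θ j), ‖c j μ‖ with hC₀
  have hC₀0 : 0 ≤ C₀ := Finset.sum_nonneg fun j _ => Finset.sum_nonneg fun μ _ => norm_nonneg _
  -- The summands secure, in turn, `R ≥ 1`, `R ≥ 2ρ` and that `R` absorbs the constant of one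
  -- recurrence step. `C₀` covers the initial coefficients.
  set R : ℝ := 1 + 2 * ρ + Γ₀ * (B * (2 * n + 1)) with hR
  have hX : 0 ≤ Γ₀ * (B * (2 * n + 1)) := by positivity
  have hR1 : 1 ≤ R := by linarith
  refine ⟨1 + C₀, R, by linarith, hR1, ?_⟩
  intro j μ
  induction μ using Nat.strong_induction_on generalizing j with
  | _ μ ih =>
    by_cases hμ : μ < startIndex θ j
    · have h1 : ‖c j μ‖ ≤ C₀ := by
        refine (Finset.single_le_sum (f := fun μ => ‖c j μ‖) (fun _ _ => norm_nonneg _)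
          (Finset.mem_range.2 hμ)).trans ?_
        exact Finset.single_le_sum
          (f := fun j => ∑ μ ∈ Finset.range (startIndex θ j), ‖c j μ‖)
          (fun _ _ => Finset.sum_nonneg fun _ _ => norm_nonneg _) (Finset.mem_univ j)
      calc ‖c j μ‖ ≤ (1 + C₀) * 1 := by linarith
        _ ≤ _ := mul_le_mul_of_nonneg_left (one_le_pow₀ hR1) (by linarith)
    · have hs := startIndex_pos hθ j
      have hμ' := not_lt.1 hμ
      rw [hc μ j, if_neg hμ, norm_mul, Complex.norm_real]
      have hx : (θ j : ℝ) ≤ (μ : ℝ) / commonDen θ := by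
        rw [← startIndex_div hθ j]
        exact div_le_div_of_nonneg_right (by exact_mod_cast hμ') (Nat.cast_nonneg _)
      have hG : ‖Real.Gamma ((μ : ℝ) / commonDen θ - θ j + 1) /
          Real.Gamma ((μ : ℝ) / commonDen θ + 1)‖ ≤ Γ₀ := by
        rw [Real.norm_of_nonneg (div_nonneg (Real.Gamma_pos_of_pos (by linarith)).le
          (Real.Gamma_pos_of_pos (by linarith [hθ' j])).le)]
        have := Gamma_div_Gamma_add_le (y := (μ : ℝ) / commonDen θ - θ j + 1) (θ := θ j)
          (by linarith) (hθ' j)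
        rw [show (μ : ℝ) / commonDen θ - θ j + 1 + θ j = (μ : ℝ) / commonDen θ + 1 by ring] at this
        exact this.trans (Finset.single_le_sum (f := fun j => 1 / Real.Gamma (1 + (θ j : ℝ)))
          (fun j _ => hΓpos j) (Finset.mem_univ j))
      have hr := norm_recurrenceRhs_le (c := c) (N := μ - startIndex θ j) (C := 1 + C₀) (R := R)
        hB hρ (by linarith) (by linarith) (hb j) (fun r k hk => ih k (by omega) r)
      -- The constant of the step costs one power of `R`, paid for by the index shift of at least
      -- one.
      calc _ ≤ Γ₀ * (B * (2 * n + 1) * (1 + C₀) * R ^ (μ - startIndex θ j)) :=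
            mul_le_mul hG hr (norm_nonneg _) hΓ₀0
        _ = (Γ₀ * (B * (2 * n + 1))) * ((1 + C₀) * R ^ (μ - startIndex θ j)) := by ring
        _ ≤ R * ((1 + C₀) * R ^ (μ - startIndex θ j)) :=
            mul_le_mul_of_nonneg_right (by linarith) (by positivity)
        _ = (1 + C₀) * R ^ (μ - startIndex θ j + 1) := by ring
        _ ≤ _ := mul_le_mul_of_nonneg_left (pow_le_pow_right₀ hR1 (by omega)) (by linarith)

theorem rpow_natCast_div_natCast {t : ℝ} (ht : 0 ≤ t) (q μ : ℕ) :
    t ^ ((μ : ℝ) / q) = (t ^ (1 / (q : ℝ))) ^ μ := by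
  rw [← Real.rpow_natCast, ← Real.rpow_mul ht]
  congr 1; ring

/-- Only multiples `q k` survive, and `q k < θ_j q` is equivalent to `k < ⌈θ_j⌉`. -/
theorem IsCoeffFamily.sum_range_startIndex {n : ℕ} {θ : Fin n → ℚ} (hθ : ∀ j, 0 < θ j) {ω : ℝ}
    {a : Fin n → Fin (n + 1) → ℕ → ℂ} {v0 : Fin n → ℕ → ℂ} {c : Fin n → ℕ → ℂ}
    (hc : IsCoeffFamily θ ω a v0 c) (j : Fin n) (z : ℝ) :
    ∑ μ ∈ Finset.range (startIndex θ j), c j μ * (z : ℂ) ^ μ =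
      initialPoly θ v0 j (z ^ commonDen θ) := by
  have hq := commonDen_pos θ
  have hiff : ∀ k : ℕ, k < ⌈(θ j : ℝ)⌉₊ ↔ commonDen θ * k < startIndex θ j := by
    intro k
    have hq' : (0 : ℝ) < commonDen θ := by exact_mod_cast hq
    rw [Nat.lt_ceil, ← startIndex_div hθ j, lt_div_iff₀ hq', mul_comm]
    exact_mod_cast Iff.rfl
  rw [initialPoly]
  symm
  refine Finset.sum_of_injOn (fun k => commonDen θ * k)
    (fun x _ y _ h => Nat.eq_of_mul_eq_mul_left hq h) (fun k hk => ?_) (fun μ hμ h => ?_)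
    (fun k hk => ?_)
  · simp only [Finset.coe_range, mem_Iio] at hk ⊢
    exact (hiff k).1 hk
  · rw [hc.low j μ (Finset.mem_range.1 hμ), if_neg, zero_mul]
    rintro ⟨k, rfl⟩
    exact h ⟨k, Finset.mem_coe.2 (Finset.mem_range.2 ((hiff k).2 (Finset.mem_range.1 hμ))), rfl⟩
  · rw [hc.low j _ ((hiff k).1 (Finset.mem_range.1 hk)), if_pos (dvd_mul_right _ _),
      Nat.mul_div_cancel_left k hq, pow_mul]
    push_cast; rfl

/-! ### Local series solutions and the main theorem. -/

/-- The amplitude `z ↦ p̄(z) e^{-iωz^q}` is the sum of its Taylor series near `0`. -/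
theorem exists_hasAbsPowerSum_amplitudeCoeff {pbar : ℝ → ℂ} (han : AnalyticAt ℝ pbar 0) (q : ℕ)
    (ω : ℝ) : ∃ r : ℝ, 0 < r ∧ ∀ z ∈ Icc 0 r, HasAbsPowerSum (amplitudeCoeff q ω pbar) z
      (pbar z * Complex.exp (-(Complex.I * (ω : ℂ) * (z : ℂ) ^ q))) := by
  refine AnalyticAt.exists_hasAbsPowerSum
    (g := fun z : ℝ => pbar z * Complex.exp (-(Complex.I * (ω : ℂ) * (z : ℂ) ^ q))) (han.mul ?_)
  have h1 : AnalyticAt ℝ (fun z : ℝ => (z : ℂ)) 0 := Complex.ofRealCLM.analyticAt 0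
  have h2 : AnalyticAt ℝ (fun z : ℝ => -(Complex.I * (ω : ℂ) * (z : ℂ) ^ q)) 0 :=
    ((analyticAt_const (v := Complex.I * (ω : ℂ))).mul (h1.pow q)).neg
  have h3 : AnalyticAt ℝ Complex.exp (-(Complex.I * (ω : ℂ) * ((0 : ℝ) : ℂ) ^ q)) :=
    analyticAt_cexp.restrictScalars
  exact AnalyticAt.comp (g := Complex.exp)
    (f := fun z : ℝ => -(Complex.I * (ω : ℂ) * (z : ℂ) ^ q)) h3 h2

/-- Linear Caputo systems with coefficients analytic in `t^{1/q}` have, near the origin, solutions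
given by their generalized power series. -/
theorem exists_isCaputoSolution_series {n : ℕ} {θ : Fin n → ℚ} (hθ : ∀ j, 0 < θ j)
    (hden : ∀ j, 2 ≤ (θ j).den) {ω : ℝ} {a : Fin n → Fin (n + 1) → ℕ → ℂ} {v0 : Fin n → ℕ → ℂ}
    {c : Fin n → ℕ → ℂ} (hc : IsCoeffFamily θ ω a v0 c) {p : Fin n → Fin (n + 1) → ℝ → ℂ} {δ : ℝ}
    (hδ : 0 < δ)
    (hp : ∀ j r, ∀ t ∈ Icc 0 δ, HasAbsPowerSum (modulatedCoeff (commonDen θ) ω (a j r))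
      (t ^ (1 / (commonDen θ : ℝ))) (p j r t))
    (hcs : ∀ j, ∀ t ∈ Icc 0 δ, Summable fun μ => ‖c j μ * ((t ^ (1 / (commonDen θ : ℝ)) : ℝ) : ℂ) ^ μ‖) :
    ∃ u : Fin n → ℝ → ℂ, IsCaputoSolution θ p v0 δ u ∧ ∀ j, ∀ t ∈ Icc 0 δ,
      HasSum (fun k => c j (startIndex θ j + k) * fracPow (commonDen θ) (startIndex θ j + k) t)
        (u j t - initialPoly θ v0 j t) := by
  have hq := commonDen_pos θ
  have hq0 : (commonDen θ : ℝ) ≠ 0 := by exact_mod_cast hq.ne'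
  have hexp : ∀ j (k : ℕ), (θ j : ℝ) + (k : ℝ) / commonDen θ =
      ((startIndex θ j + k : ℕ) : ℝ) / commonDen θ := fun j k => by
    rw [← startIndex_div hθ j]; push_cast; ring
  let d : Fin n → ℕ → ℂ := fun j =>
    recurrenceRhs (fun r => modulatedCoeff (commonDen θ) ω (a j r)) c
  -- `V` is the full series, initial part included; `d j` are the coefficients of the right-hand
  -- side evaluated at `V`.
  let V : Fin n → ℝ → ℂ := fun j t =>
    ∑' μ, c j μ * ((t ^ (1 / (commonDen θ : ℝ)) : ℝ) : ℂ) ^ μ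
  have hV : ∀ j, ∀ t ∈ Icc 0 δ, HasAbsPowerSum (c j) (t ^ (1 / (commonDen θ : ℝ))) (V j t) :=
    fun j t ht => ⟨hcs j t ht, (hcs j t ht).of_norm.hasSum⟩
  have hd : ∀ j, ∀ t ∈ Icc 0 δ, HasAbsPowerSum (d j) (t ^ (1 / (commonDen θ : ℝ)))
      (∑ r : Fin n, p j r.castSucc t * V r t + p j (Fin.last n) t) := fun j t ht =>
    (HasAbsPowerSum.sum fun r _ => (hp j _ t ht).mul (hV r t ht)).add (hp j _ t ht)
  have hfrac : ∀ (μ : ℕ) (t : ℝ), t ∈ Icc 0 δ →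
      ((t ^ ((μ : ℝ) / commonDen θ) : ℝ) : ℂ) = ((t ^ (1 / (commonDen θ : ℝ)) : ℝ) : ℂ) ^ μ :=
    fun μ t ht => by rw [rpow_natCast_div_natCast ht.1]; push_cast; rfl
  have hδm : δ ∈ Icc 0 δ := ⟨hδ.le, le_rfl⟩
  have hnorm : ∀ (x : ℂ) (μ : ℕ), ‖x‖ * δ ^ ((μ : ℝ) / commonDen θ) =
      ‖x * ((δ ^ (1 / (commonDen θ : ℝ)) : ℝ) : ℂ) ^ μ‖ := fun x μ => by
    rw [← hfrac μ δ hδm, norm_mul, Complex.norm_real, Real.norm_of_nonneg (Real.rpow_nonneg hδ.le _)]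
  have hcd : ∀ j (k : ℕ), c j (startIndex θ j + k) =
      ((Real.Gamma ((k : ℝ) / commonDen θ + 1) /
        Real.Gamma ((θ j : ℝ) + (k : ℝ) / commonDen θ + 1) : ℝ) : ℂ) * d j k := by
    intro j k
    rw [(isCoeffFamily_iff ω a v0 c).1 hc _ j, if_neg (by omega), Nat.add_sub_cancel_left, ← hexp,
      add_sub_cancel_left]
  choose u hAC hinit hser heq using fun j => exists_hasCaputoDerivAt_series
    (θ := (θ j : ℝ)) (S := δ) (by exact_mod_cast hθ j) (rat_lt_natCeil (hden j)) hδ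
    (q := commonDen θ) (c := fun k => c j (startIndex θ j + k)) (d := d j) (hcd j)
    (by
      simp only [hexp, hnorm]
      exact (hcs j δ hδm).comp_injective (add_right_injective (startIndex θ j)))
    (by
      simp only [hnorm]
      exact (hd j δ hδm).1) (v0 j)
  have hser' : ∀ j, ∀ t ∈ Icc 0 δ,
      HasSum (fun k => c j (startIndex θ j + k) * fracPow (commonDen θ) (startIndex θ j + k) t)
        (u j t - initialPoly θ v0 j t) := fun j t ht => by
    have := hser j t ht
    simp only [hexp] at this
    exact this
  -- This closes the loop: splitting off the initial part of `V` leaves the series of `u j - ψ_j`,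
  -- so the right-hand side formed with `V` is the one formed with `u`.
  have huV : ∀ j, ∀ t ∈ Icc 0 δ, u j t = V j t := by
    intro j t ht
    have h1 := hser' j t ht
    simp only [fracPow, hfrac _ t ht, add_comm (startIndex θ j)] at h1
    have h2 := (hasSum_nat_add_iff (f := fun μ => c j μ *
      ((t ^ (1 / (commonDen θ : ℝ)) : ℝ) : ℂ) ^ μ) (startIndex θ j)).1 h1
    rw [hc.sum_range_startIndex hθ, one_div, Real.rpow_inv_natCast_pow ht.1 hq.ne',
      sub_add_cancel, ← one_div] at h2
    exact h2.unique (hV j t ht).2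
  refine ⟨u, ⟨hAC, hinit, fun j t ht => ?_⟩, hser'⟩
  have htI : t ∈ Icc 0 δ := ⟨ht.1.le, ht.2⟩
  refine heq j t ht _ ?_
  simp only [hfrac _ t htI, huV _ t htI]
  exact (hd j t htI).2

theorem theorem2p1 {n : ℕ} (θ : Fin n → ℚ) (hθ : ∀ j, 0 < θ j) (hden : ∀ j, 2 ≤ (θ j).den)
    (T : ℝ) (hT : 0 < T) (ω : ℝ)
    (p f : Fin n → Fin (n + 1) → ℝ → ℂ)
    (hcont : ∀ j r, ContinuousOn (p j r) (Icc 0 T))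
    (hosc : ∀ j r, ∀ t ∈ Icc 0 T,
      p j r t = f j r t * Complex.exp (Complex.I * (ω : ℂ) * (t : ℂ)))
    (pbar : Fin n → Fin (n + 1) → ℝ → ℂ)
    (han : ∀ j r, AnalyticAt ℝ (pbar j r) 0)
    (hpbar : ∀ j r, ∀ t ∈ Icc 0 T, p j r t = pbar j r (t ^ (1 / (commonDen θ : ℝ))))
    (v0 : Fin n → ℕ → ℂ) :
    -- the coefficients: the recurrence has exactly one solution
    ∃ c : Fin n → ℕ → ℂ,
      (IsCoeffFamily θ ω (fun j r => amplitudeCoeff (commonDen θ) ω (pbar j r)) v0 c ∧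
        ∀ c', IsCoeffFamily θ ω (fun j r => amplitudeCoeff (commonDen θ) ω (pbar j r)) v0 c' →
          c' = c) ∧
      ∃ δ : ℝ, 0 < δ ∧ δ ≤ T ∧
        -- the amplitudes `f_{j,r}` have the expansions whose coefficients enter the recurrence
        (∀ j r, ∀ t ∈ Icc 0 δ,
          HasSum (fun m => amplitudeCoeff (commonDen θ) ω (pbar j r) m *
            fracPow (commonDen θ) m t) (f j r t)) ∧
        -- the series converges absolutely and uniformly on `[0, δ]`
        (∀ j, Summable fun μ => ‖c j μ‖ * δ ^ ((μ : ℝ) / (commonDen θ : ℝ))) ∧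
        -- a solution exists near the origin
        (∃ u : Fin n → ℝ → ℂ, IsCaputoSolution θ p v0 δ u) ∧
        -- every solution is given by the series near the origin
        ∀ S : ℝ, 0 < S → S ≤ T → ∀ v : Fin n → ℝ → ℂ, IsCaputoSolution θ p v0 S v →
          ∀ j, ∀ t ∈ Icc 0 (min δ S),
            HasSum (fun k => c j (startIndex θ j + k) *
              fracPow (commonDen θ) (startIndex θ j + k) t) (v j t - initialPoly θ v0 j t) := by
  obtain ⟨c, hc, huniq⟩ := existsUnique_isCoeffFamily hθ ω
    (fun j r => amplitudeCoeff (commonDen θ) ω (pbar j r)) v0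
  refine ⟨c, ⟨hc, huniq⟩, ?_⟩
  have hq := commonDen_pos θ
  -- a common radius for the Taylor expansions
  obtain ⟨r₁, hr₁, ha⟩ : ∃ r₁ : ℝ, 0 < r₁ ∧ ∀ j r, ∀ z ∈ Icc 0 r₁,
      HasAbsPowerSum (amplitudeCoeff (commonDen θ) ω (pbar j r)) z
        (pbar j r z * Complex.exp (-(Complex.I * (ω : ℂ) * (z : ℂ) ^ commonDen θ))) := by
    have h1 : ∀ᶠ r₁ in nhdsWithin (0 : ℝ) (Ioi 0), ∀ j r, ∀ z ∈ Icc 0 r₁,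
        HasAbsPowerSum (amplitudeCoeff (commonDen θ) ω (pbar j r)) z
          (pbar j r z * Complex.exp (-(Complex.I * (ω : ℂ) * (z : ℂ) ^ commonDen θ))) := by
      simp only [Filter.eventually_all]
      intro j r
      obtain ⟨R, hR, h⟩ := exists_hasAbsPowerSum_amplitudeCoeff (han j r) (commonDen θ) ω
      filter_upwards [Ioc_mem_nhdsGT hR] with x hx z hz
      exact h z ⟨hz.1, hz.2.trans hx.2⟩
    obtain ⟨r₁, h, h0⟩ := (h1.and self_mem_nhdsWithin).exists
    exact ⟨r₁, h0, h⟩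
  have hb : ∀ j r, ∀ z ∈ Icc 0 r₁, HasAbsPowerSum
      (modulatedCoeff (commonDen θ) ω (amplitudeCoeff (commonDen θ) ω (pbar j r))) z
        (pbar j r z) := fun j r z hz => by
    -- Modulation cancels the factor `exp (-iωz^q)` and leaves an expansion of `pbar` itself.
    have h1 := (ha j r z hz).modulated hq ω
    rwa [mul_assoc, ← Complex.exp_add, neg_add_cancel, Complex.exp_zero, mul_one] at h1
  -- geometric growth of the coefficients
  choose B hB0 hB using fun j r => (hb j r r₁ ⟨hr₁.le, le_rfl⟩).exists_bound hr₁
  obtain ⟨C, R, hC, hR, hcR⟩ := hc.exists_norm_le hθ (B := ∑ j, ∑ r, B j r) (ρ := 1 / r₁)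
    (Finset.sum_nonneg fun j _ => Finset.sum_nonneg fun r _ => hB0 j r) (by positivity)
    fun j r k => (hB j r k).trans <| mul_le_mul_of_nonneg_right
      ((Finset.single_le_sum (fun r _ => hB0 j r) (Finset.mem_univ r)).trans
        (Finset.single_le_sum (f := fun j => ∑ r, B j r)
          (fun j _ => Finset.sum_nonneg fun r _ => hB0 j r) (Finset.mem_univ j))) (by positivity)
  have hR0 : 0 < R := by linarith
  -- `z₀ ≤ r₁` keeps the Taylor series convergent, `R z₀ ≤ 1/2` makes the solution series geometric,
  -- and `z₀ ≤ min 1 T` gives `z₀^q ≤ T`.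
  set z₀ : ℝ := min (min r₁ (1 / (2 * R))) (min 1 T) with hz₀
  have hz₀0 : 0 < z₀ := lt_min (lt_min hr₁ (by positivity)) (lt_min one_pos hT)
  have hz₀r : z₀ ≤ r₁ := (min_le_left _ _).trans (min_le_left _ _)
  have hz₀R : R * z₀ ≤ 1 / 2 := by
    have : z₀ ≤ 1 / (2 * R) := (min_le_left _ _).trans (min_le_right _ _)
    calc R * z₀ ≤ R * (1 / (2 * R)) := mul_le_mul_of_nonneg_left this hR0.le
      _ = 1 / 2 := by field_simp
  have hz₀1 : z₀ ≤ 1 := (min_le_right _ _).trans (min_le_left _ _)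
  have hz₀T : z₀ ≤ T := (min_le_right _ _).trans (min_le_right _ _)
  set δ : ℝ := z₀ ^ commonDen θ with hδ
  have hδ0 : 0 < δ := pow_pos hz₀0 _
  have hδT : δ ≤ T := (pow_le_of_le_one hz₀0.le hz₀1 hq.ne').trans hz₀T
  have hδz : δ ^ (1 / (commonDen θ : ℝ)) = z₀ := by
    rw [hδ, one_div, Real.pow_rpow_inv_natCast hz₀0.le hq.ne']
  have hz : ∀ t ∈ Icc 0 δ, t ^ (1 / (commonDen θ : ℝ)) ∈ Icc 0 z₀ := fun t ht =>
    ⟨Real.rpow_nonneg ht.1 _, by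
      rw [← hδz]; exact Real.rpow_le_rpow ht.1 ht.2 (by positivity)⟩
  have hzr : ∀ t ∈ Icc 0 δ, t ^ (1 / (commonDen θ : ℝ)) ∈ Icc 0 r₁ := fun t ht =>
    ⟨(hz t ht).1, (hz t ht).2.trans hz₀r⟩
  have hδsub : Icc 0 δ ⊆ Icc 0 T := Icc_subset_Icc_right hδT
  have hcz : ∀ j, Summable fun μ => ‖c j μ‖ * z₀ ^ μ := fun j => by
    refine Summable.of_nonneg_of_le (fun μ => by positivity) (fun μ => ?_)
      (summable_geometric_two.mul_left C)
    calc ‖c j μ‖ * z₀ ^ μ ≤ C * R ^ μ * z₀ ^ μ :=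
          mul_le_mul_of_nonneg_right (hcR j μ) (by positivity)
      _ = C * (R * z₀) ^ μ := by rw [mul_pow]; ring
      _ ≤ C * (1 / 2) ^ μ := by gcongr
  have hcs : ∀ j, ∀ t ∈ Icc 0 δ,
      Summable fun μ => ‖c j μ * ((t ^ (1 / (commonDen θ : ℝ)) : ℝ) : ℂ) ^ μ‖ := fun j t ht => by
    refine Summable.of_nonneg_of_le (fun _ => norm_nonneg _) (fun μ => ?_) (hcz j)
    rw [norm_mul, norm_pow, Complex.norm_real, Real.norm_of_nonneg (hz t ht).1]
    exact mul_le_mul_of_nonneg_left (pow_le_pow_left₀ (hz t ht).1 (hz t ht).2 μ) (norm_nonneg _)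
  obtain ⟨u, hu, hser⟩ := exists_isCaputoSolution_series hθ hden hc (p := p) hδ0
    (fun j r t ht => by
      rw [hpbar j r t (hδsub ht)]; exact hb j r _ (hzr t ht)) hcs
  refine ⟨δ, hδ0, hδT, fun j r t ht => ?_, fun j => ?_, ⟨u, hu⟩, fun S hS hST v hv j t ht => ?_⟩
  · have h1 := (ha j r _ (hzr t ht)).2
    have hzt : ((t ^ (1 / (commonDen θ : ℝ)) : ℝ) : ℂ) ^ commonDen θ = (t : ℂ) := by
      rw [← Complex.ofReal_pow, one_div, Real.rpow_inv_natCast_pow ht.1 hq.ne']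
    rw [← hpbar j r t (hδsub ht), hosc j r t (hδsub ht), hzt, mul_assoc, ← Complex.exp_add,
      add_neg_cancel, Complex.exp_zero, mul_one] at h1
    refine h1.congr_fun fun m => ?_
    rw [fracPow, rpow_natCast_div_natCast ht.1, Complex.ofReal_pow]
  · refine (hcz j).congr fun μ => ?_
    rw [rpow_natCast_div_natCast hδ0.le, hδz]
  · have h1 := hu.eqOn hθ hden hδ0 hS (fun j r => (hcont j r).mono
      (Icc_subset_Icc_right ((min_le_left _ _).trans hδT))) hv j ht
    rw [← h1]
    exact hser j t ⟨ht.1, ht.2.trans (min_le_left _ _)⟩
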